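/- **Setting.** Let $\Sigma$ be an alphabet and $\bar\Sigma=\Sigma\cup\{\varepsilon\}$, where $\varepsilon$ is the empty string. A *weight function* is a map $w:\bar\Sigma\times\bar\Sigma\to\mathbb{R}_{\ge 0}\cup\{\infty\}$ with $w(a,a)=0$ for all $a$; it is *normalized* if $w(a,b)\ge 1$ whenever $a\ne b$. (No triangle inequality or symmetry is assumed.) Consider strings over the labelled parentheses $(_a,\ )_a$ with $a\in\Sigma$. *Forests* are the balanced strings: the empty string is a forest, and if $F,G$ are forests, then so are $FG$ and $(_a F\,)_a$. A *tree* is a string $(_a F\,)_a$ with $F$ a forest. A *node* of a forest $F$ is a pair $u=(o(u),c(u))$ of positions such that the fragment $F[o(u)..c(u)]$ is a tree (an opening parenthesis and its matching closing parenthesis). An *alignment* of $F$ onto $G$ is a sequence of pairs of integers from $(0,0)$ to $(|F|,|G|)$ in which each $(x,y)$ is followed by $(x+1,y)$ ($F[x]$ is deleted), $(x,y+1)$ ($G[y]$ is inserted) or $(x+1,y+1)$ ($F[x]$ is aligned to $G[y]$). It is a *forest alignment* if for every node $u$ of $F$, either both $F[o(u)]$ and $F[c(u)]$ are deleted, or there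 is a node $v$ of $G$ such that $F[o(u)]$ is aligned to $G[o(v)]$ and $F[c(u)]$ is aligned to $G[c(v)]$. Its cost is one half of the sum of the costs of its steps, where a step costs $w(a,\varepsilon)$, $w(\varepsilon,b)$ or $w(a,b)$, respectively, with $a,b$ the labels of the parentheses involved. Let $\mathsf{ted}^w(F,G)$ be the minimum cost of a forest alignment of $F$ onto $G$, and let $\mathsf{ted}^w_{\le k}(F,G)$ equal $\mathsf{ted}^w(F,G)$ if this is at most $k$, and $\infty$ otherwise. A *context* is a pair $C=\langle C_L;C_R\rangle$ of non-empty strings of parentheses such that $C_LC_R$ is a tree. Put $C\star D=\langle C_LD_L;D_RC_R\rangle$ for contexts $C,D$, and $C\star G=C_L\,G\,C_R$ for a forest $G$. For $e\ge 1$, the vertical power $Q^e$ is the composition $Q\star\cdots\star Q$ of $e$ copies of $Q$. A context $C$ *occurs* in a forest $F$ at a node $u$ of $F$ if $F[o(u)..c(u)]=C\star G$ for some forest $G$; replacing this occurrence by a context $C'$ means replacing the fragment $F[o(u)..c(u)]$ of $F$ by $C'\star G$. For an integer $k\ge 0$, contexts $P$ and $P'$ are *$\mathsf{ted}^w_{\le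 k}$-equivalent* if, for all forests $F$ and $G$ in which $P$ occurs at nodes $u$ and $v$, respectively, with $|o(u)-o(v)|\le 2k$ and $|c(u)-c(v)|\le 2k$, we have $\mathsf{ted}^w_{\le k}(F,G)=\mathsf{ted}^w_{\le k}(F',G')$, where $F'$ and $G'$ are obtained from $F$ and $G$ by replacing the occurrences of $P$ at $u$ and at $v$ by $P'$. **Lemma.** Let $k\ge 1$ be an integer, let $Q$ be a context, and let $e,e'\ge 6k$ be integers. Then $Q^e$ and $Q^{e'}$ are $\mathsf{ted}^w_{\le k}$-equivalent for every normalized weight function $w$. -/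

import Mathlib

open scoped NNReal ENNReal

namespace TreeEdit

/-- Parentheses with labels over the alphabet `α`. -/
inductive Paren (α : Type*) where
  | op (a : α) : Paren α
  | cl (a : α) : Paren α

/-- The label of a parenthesis. -/
def Paren.label {α : Type*} : Paren α → α
  | .op a => a
  | .cl a => a

/-- Forests with node labels over `α`: balanced strings of parentheses. -/
inductive IsForest {α : Type*} : List (Paren α) → Prop where
  | nil : IsForest []
  | append {F G : List (Paren α)} : IsForest F → IsForest G → IsForest (F ++ G)
  | wrap {F : List (Paren α)} (a : α) : IsForest F → IsForest ([Paren.op a] ++ F ++ [Paren.cl a])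

/-- A tree: a forest whose first and last characters form a node. -/
def IsTree {α : Type*} (T : List (Paren α)) : Prop :=
  ∃ (a : α) (F : List (Paren α)), IsForest F ∧ T = [Paren.op a] ++ F ++ [Paren.cl a]

/-- The fragment `X[i..j)`. -/
def frag {β : Type*} (X : List β) (i j : ℕ) : List β := (X.take j).drop i

/-- `u = (o(u), c(u))` is a node of `F`: a pair of positions of an opening parenthesis and of the
closing parenthesis matching it, that is, `F[o(u)..c(u)]` is a tree. -/
def IsNode {α : Type*} (F : List (Paren α)) (u : ℕ × ℕ) : Prop :=
  u.1 < u.2 ∧ u.2 < F.length ∧ IsTree (frag F u.1 (u.2 + 1))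

/-- One step of an alignment. -/
def Step (p q : ℕ × ℕ) : Prop :=
  q = (p.1 + 1, p.2 + 1) ∨ q = (p.1 + 1, p.2) ∨ q = (p.1, p.2 + 1)

/-- `A` is an alignment of `X` onto `Y`: a sequence of pairs from `(0, 0)` to `(|X|, |Y|)`. -/
def IsAlignment {β : Type*} (A : List (ℕ × ℕ)) (X Y : List β) : Prop :=
  A.head? = some (0, 0) ∧ A.getLast? = some (X.length, Y.length) ∧ A.IsChain Step

/-- `A` deletes `X[x]`. -/
def Deletes (A : List (ℕ × ℕ)) (x : ℕ) : Prop :=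
  ∃ y : ℕ, [(x, y), (x + 1, y)] <:+: A

/-- `A` aligns `X[x]` to `Y[y]`. -/
def Aligns (A : List (ℕ × ℕ)) (x y : ℕ) : Prop :=
  [(x, y), (x + 1, y + 1)] <:+: A

/-- Weight functions on `Option α`; the value `none` is the empty string `ε`. -/
def IsWeight {β : Type*} (w : Option β → Option β → ℝ≥0∞) : Prop :=
  ∀ a, w a a = 0

/-- Normalized weight functions. -/
def IsNormalized {β : Type*} (w : Option β → Option β → ℝ≥0∞) : Prop :=
  ∀ a b, a ≠ b → 1 ≤ w a b

/-- The cost of the step from `p` to `q`: a deletion costs `w(X[x], ε)`, an insertion costs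
`w(ε, Y[y])`, and aligning `X[x]` to `Y[y]` costs `w(X[x], Y[y])` (which is `0` for a match). -/
noncomputable def stepCost {β : Type*} (w : Option β → Option β → ℝ≥0∞) (X Y : List β)
    (p q : ℕ × ℕ) : ℝ≥0∞ :=
  w (if p.1 < q.1 then X[p.1]? else none) (if p.2 < q.2 then Y[p.2]? else none)

/-- The cost of a sequence of pairs, summed over all pairs of consecutive elements. -/
noncomputable def edCost {β : Type*} (w : Option β → Option β → ℝ≥0∞) (X Y : List β) :
    List (ℕ × ℕ) → ℝ≥0∞
  | [] => 0
  | [_] => 0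
  | p :: q :: A => stepCost w X Y p q + edCost w X Y (q :: A)

/-- Forest alignments of `F` onto `G`. -/
def IsForestAlignment {α : Type*} (A : List (ℕ × ℕ)) (F G : List (Paren α)) : Prop :=
  IsAlignment A F G ∧
    ∀ u : ℕ × ℕ, IsNode F u →
      (Deletes A u.1 ∧ Deletes A u.2) ∨
        ∃ v : ℕ × ℕ, IsNode G v ∧ Aligns A u.1 v.1 ∧ Aligns A u.2 v.2

/-- The weight function on parentheses induced by a weight function on labels. -/
def parenWeight {α : Type*} (w : Option α → Option α → ℝ≥0∞) :
    Option (Paren α) → Option (Paren α) → ℝ≥0∞ :=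
  fun p q => w (p.map Paren.label) (q.map Paren.label)

/-- The cost of a forest alignment. -/
noncomputable def tedCost {α : Type*} (w : Option α → Option α → ℝ≥0∞) (F G : List (Paren α))
    (A : List (ℕ × ℕ)) : ℝ≥0∞ :=
  edCost (parenWeight w) F G A / 2

/-- The weighted tree edit distance. The infimum is over a finite nonempty set. -/
noncomputable def ted {α : Type*} (w : Option α → Option α → ℝ≥0∞) (F G : List (Paren α)) :
    ℝ≥0∞ :=
  ⨅ (A : List (ℕ × ℕ)) (_ : IsForestAlignment A F G), tedCost w F G A

/-- The thresholded weighted tree edit distance. -/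
noncomputable def tedLE {α : Type*} (w : Option α → Option α → ℝ≥0∞) (k : ℝ≥0)
    (F G : List (Paren α)) : ℝ≥0∞ :=
  if ted w F G ≤ (k : ℝ≥0∞) then ted w F G else ⊤

/-- A pair of strings of parentheses. -/
@[ext]
structure StringPair (α : Type*) where
  left : List (Paren α)
  right : List (Paren α)

namespace StringPair

/-- A context: a tree with a hole strictly inside it, so that the opening parenthesis of the root
lies in the left half and the closing parenthesis of the root lies in the right half. -/
def IsContext {α : Type*} (C : StringPair α) : Prop :=
  IsTree (C.left ++ C.right) ∧ C.left ≠ [] ∧ C.right ≠ []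

/-- Vertical composition. -/
def comp {α : Type*} (C D : StringPair α) : StringPair α :=
  ⟨C.left ++ D.left, D.right ++ C.right⟩

/-- Vertical composition with a forest, which fills the hole. -/
def fill {α : Type*} (C : StringPair α) (F : List (Paren α)) : List (Paren α) :=
  C.left ++ F ++ C.right

/-- Vertical power: the vertical composition of `e` copies of `Q`. -/
def pow {α : Type*} (Q : StringPair α) : ℕ → StringPair α
  | 0 => ⟨[], []⟩
  | e + 1 => Q.comp (Q.pow e)

/-- `C` occurs in `F` at the node `u`. -/
def OccursAt {α : Type*} (C : StringPair α) (F : List (Paren α)) (u : ℕ × ℕ) : Prop :=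
  IsNode F u ∧ ∃ G : List (Paren α), IsForest G ∧ frag F u.1 (u.2 + 1) = C.fill G

/-- The string obtained from `F` by replacing the occurrence of `P` at the node `u` by `P'`. -/
def replaceAt {α : Type*} (P P' : StringPair α) (F : List (Paren α)) (u : ℕ × ℕ) :
    List (Paren α) :=
  frag F 0 u.1 ++ P'.left ++ frag F (u.1 + P.left.length) (u.2 + 1 - P.right.length) ++
    P'.right ++ frag F (u.2 + 1) F.length

/-- `P` and `P'` are `ted^w_{≤ k}`-equivalent contexts. -/
def TedEquiv {α : Type*} (k : ℕ) (w : Option α → Option α → ℝ≥0∞) (P P' : StringPair α) : Prop :=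
  P.IsContext ∧ P'.IsContext ∧
    ∀ (F G : List (Paren α)) (u v : ℕ × ℕ), IsForest F → IsForest G →
      P.OccursAt F u → P.OccursAt G v →
      |(u.1 : ℤ) - (v.1 : ℤ)| ≤ 2 * (k : ℤ) → |(u.2 : ℤ) - (v.2 : ℤ)| ≤ 2 * (k : ℤ) →
      tedLE w (k : ℝ≥0) F G =
        tedLE w (k : ℝ≥0) (replaceAt P P' F u) (replaceAt P P' G v)

end StringPair

end TreeEdit

/-! The proof is a pumping argument. Cost is half the sum of the step costs, so for a normalized
weight an alignment of cost at most `k` has at most `2k` columns that are not matches. Cut the power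
in the first forest into `e` nested layers, each consisting of one copy of the left half of `Q` and
the corresponding copy of the right half. A layer is balanced and a forest alignment deletes both
ends of a node or neither, so a layer cannot contain exactly one deletion. If deletions are counted
once and all other edits twice, a layer of weight below two is therefore aligned identically
(`ForestCols.layer_diag`), and twice the number of remaining layers plus the number of deletions is
at most `4k`.

An identically aligned layer is mapped to a fragment of the second forest that is again a node.
Nodes do not cross, so this image is constrained by two nodes of the second forest: the whole power
and its innermost copy of `Q`. Since `e ≥ 6k` and positions drift by at most `2k`, some identically
aligned layer has its two halves mapped inside the two periodic parts of the second power
(`exists_layer`, `ForestCols.exists_periodic_diag`). The offsets inside the periods may be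
arbitrary, and may differ on the two sides.

Such a layer can be replaced by `m` copies of `Q` in both forests. The result is again a forest
alignment (`ForestCols.replace`, with `ForestCols.isForest_bot`), its cost is unchanged because
matches are free, and a copy of a word inside a power of that word may be replaced by any power
regardless of its offset (`rep_replace`). So both exponents change from `n + 1` to `n + m` and the
distance does not grow (`ted_pump_add_le`). Applying this in both directions yields equality of the
thresholded distances. -/

namespace TreeEdit

variable {α β : Type*}

/-! ### Balanced strings -/

open Classical in
/-- The stack automaton that pushes the labels of opening parentheses and pops them at the
closing parentheses. -/
noncomputable def run : List α → List (Paren α) → Option (List α)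
  | st, [] => some st
  | st, .op a :: s => run (a :: st) s
  | [], .cl _ :: _ => none
  | b :: st, .cl a :: s => if b = a then run st s else none

theorem run_append (s t : List (Paren α)) :
    ∀ st : List α, run st (s ++ t) = (run st s).bind fun st' => run st' t := by
  induction s with
  | nil => intro st; simp [run]
  | cons p s ih =>
    intro st
    cases p with
    | op a => simp [run, ih]
    | cl a =>
      cases st with
      | nil => simp [run]
      | cons b st => by_cases h : b = a <;> simp [run, ih, h]

theorem IsForest.run_eq {s : List (Paren α)} (hs : IsForest s) : ∀ st, run st s = some st := by
  induction hs with
  | nil => intro st; simp [run]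
  | append _ _ h₁ h₂ => intro st; simp [run_append, h₁, h₂]
  | wrap a _ h => intro st; simp [run, run_append, h]

/-- `s` consists of forests separated by closing parentheses with the labels in `st`. -/
def Closes : List α → List (Paren α) → Prop
  | [], s => IsForest s
  | a :: st, s => ∃ f s', IsForest f ∧ s = f ++ Paren.cl a :: s' ∧ Closes st s'

theorem Closes.append {f : List (Paren α)} (hf : IsForest f) {st : List α} {s : List (Paren α)}
    (h : Closes st s) : Closes st (f ++ s) := by
  cases st with
  | nil => exact IsForest.append hf h
  | cons a st =>
    obtain ⟨g, s', hg, rfl, hs⟩ := h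
    exact ⟨f ++ g, s', hf.append hg, by simp, hs⟩

/-- An opening parenthesis pushes its label; the first block of the decomposition obtained for the
larger stack, wrapped in that label, is a tree that joins the next forest. -/
theorem closes_of_run (s : List (Paren α)) : ∀ st, run st s = some [] → Closes st s := by
  induction s with
  | nil => intro st h; simp [run] at h; subst h; exact IsForest.nil
  | cons p s ih =>
    intro st h
    cases p with
    | op a =>
      obtain ⟨f, s', hf, rfl, hs⟩ := ih (a :: st) (by simpa [run] using h)
      have := hs.append (IsForest.wrap a hf)
      simpa using this
    | cl a =>
      cases st with
      | nil => simp [run] at h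
      | cons b st =>
        by_cases hb : b = a
        · subst hb
          exact ⟨[], s, IsForest.nil, rfl, ih st (by simpa [run] using h)⟩
        · simp [run, hb] at h

theorem isForest_iff_run {s : List (Paren α)} : IsForest s ↔ run [] s = some [] :=
  ⟨fun h => h.run_eq [], fun h => closes_of_run s [] h⟩

/-- `s` consists of forests separated by opening parentheses with the labels in `st`, the
innermost one first. -/
def Opens : List α → List (Paren α) → Prop
  | [], s => IsForest s
  | a :: st, s => ∃ s' f, s = s' ++ Paren.op a :: f ∧ IsForest f ∧ Opens st s'

theorem Opens.append {f : List (Paren α)} (hf : IsForest f) {st : List α} {s : List (Paren α)}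
    (h : Opens st s) : Opens st (s ++ f) := by
  cases st with
  | nil => exact IsForest.append h hf
  | cons a st =>
    obtain ⟨s', g, rfl, hg, hs⟩ := h
    exact ⟨s', g ++ f, by simp, hg.append hf, hs⟩

theorem opens_of_run (s : List (Paren α)) : ∀ st, run [] s = some st → Opens st s := by
  induction s using List.reverseRecOn with
  | nil => intro st h; simp [run] at h; subst h; exact IsForest.nil
  | append_singleton s p ih =>
    intro st h
    rw [run_append] at h
    cases hs : run [] s with
    | none => simp [hs] at h
    | some st' =>
      rw [hs] at h
      cases p with
      | op b =>
        simp [run] at h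
        subst h
        exact ⟨s, [], by simp, IsForest.nil, ih _ hs⟩
      | cl b =>
        cases st' with
        | nil => simp [run] at h
        | cons c st' =>
          by_cases hc : c = b
          · subst hc
            simp [run] at h
            subst h
            obtain ⟨s', f, rfl, hf, hs'⟩ := ih _ hs
            simpa using hs'.append (hf.wrap c)
          · simp [run, hc] at h

/-- A balanced word acts as the identity on every stack, so the automaton cannot distinguish `c`
from `c'`. Cancellation of balanced prefixes and suffixes follows by taking the new word empty. -/
theorem IsForest.replace {s c c' t : List (Paren α)} (h : IsForest (s ++ c ++ t))
    (hc : IsForest c) (hc' : IsForest c') : IsForest (s ++ c' ++ t) := by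
  rw [isForest_iff_run] at h ⊢
  rw [← h]
  simp only [run_append]
  cases run [] s <;> simp [hc.run_eq, hc'.run_eq]

theorem IsForest.of_append_left {s t : List (Paren α)} (h : IsForest (s ++ t))
    (hs : IsForest s) : IsForest t := by
  have := IsForest.replace (s := []) (c' := []) h hs IsForest.nil
  simpa using this

theorem IsForest.of_append_right {s t : List (Paren α)} (h : IsForest (s ++ t))
    (ht : IsForest t) : IsForest s := by
  have := IsForest.replace (s := s) (t := []) (c' := []) (by simpa using h) ht IsForest.nil
  simpa using this

theorem IsTree.isForest {s : List (Paren α)} (h : IsTree s) : IsForest s := by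
  obtain ⟨a, f, hf, rfl⟩ := h
  exact hf.wrap a

/-- As `s` and `t` are non-empty, they contain the two root parentheses, and the exchange takes
place in the forest below the root. -/
theorem IsTree.replace {s c c' t : List (Paren α)} (h : IsTree (s ++ c ++ t))
    (hs : s ≠ []) (ht : t ≠ []) (hc : IsForest c) (hc' : IsForest c') :
    IsTree (s ++ c' ++ t) := by
  obtain ⟨a, f, hf, h⟩ := h
  obtain ⟨p, s, rfl⟩ := List.exists_cons_of_ne_nil hs
  obtain ⟨t, q, rfl⟩ := List.eq_nil_or_concat t |>.resolve_left ht
  have h' : p :: (s ++ c ++ t) ++ [q] = Paren.op a :: f ++ [Paren.cl a] := by simpa using h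
  obtain ⟨h₁, h₂⟩ := List.append_inj' h' rfl
  simp only [List.cons.injEq] at h₁ h₂
  obtain ⟨rfl, rfl⟩ := h₁
  obtain ⟨rfl, -⟩ := h₂
  exact ⟨a, s ++ c' ++ t, hf.replace hc hc', by simp⟩

/-! ### Heights -/

/-- The number of opening parentheses minus the number of closing ones. -/
def height : List (Paren α) → ℤ
  | [] => 0
  | .op _ :: s => height s + 1
  | .cl _ :: s => height s - 1

theorem height_append (s t : List (Paren α)) : height (s ++ t) = height s + height t := by
  induction s with
  | nil => simp [height]
  | cons p s ih => cases p <;> simp [height, ih] <;> ring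

theorem IsForest.height_eq {s : List (Paren α)} (h : IsForest s) : height s = 0 := by
  induction h with
  | nil => rfl
  | append _ _ h₁ h₂ => simp [height_append, h₁, h₂]
  | wrap a _ h => simp [height_append, height, h]

theorem IsForest.height_take {s : List (Paren α)} (h : IsForest s) :
    ∀ n, 0 ≤ height (s.take n) := by
  induction h with
  | nil => intro n; simp [height]
  | append _ _ h₁ h₂ =>
    intro n
    rw [List.take_append, height_append]
    exact add_nonneg (h₁ _) (h₂ _)
  | @wrap f a hf h =>
    intro n
    cases n with
    | zero => simp [height]
    | succ n =>
      have h1 : ([Paren.op a] ++ f ++ [Paren.cl a]).take (n + 1)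
          = Paren.op a :: (f.take n ++ [Paren.cl a].take (n - f.length)) := by
        simp [List.take_append]
      rw [h1]
      simp only [height, height_append]
      have h2 := h n
      have h3 : -1 ≤ height ([Paren.cl a].take (n - f.length)) := by
        cases n - f.length <;> simp [height]
      linarith

theorem IsTree.height_take {s : List (Paren α)} (h : IsTree s) {n : ℕ} (h0 : 0 < n)
    (hn : n < s.length) : 0 < height (s.take n) := by
  obtain ⟨a, f, hf, rfl⟩ := h
  obtain ⟨n, rfl⟩ := Nat.exists_eq_succ_of_ne_zero h0.ne'
  have h1 : ([Paren.op a] ++ f ++ [Paren.cl a]).take (n + 1) = Paren.op a :: f.take n := by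
    simp at hn
    simp [List.take_append, Nat.sub_eq_zero_of_le (show n ≤ f.length by omega)]
  rw [Nat.succ_eq_add_one, h1]
  have := hf.height_take n
  simp only [height]
  omega

/-! ### Nodes -/

theorem isNode_iff {F : List (Paren α)} {u : ℕ × ℕ} :
    IsNode F u ↔ ∃ P T S, F = P ++ T ++ S ∧ IsTree T ∧ P.length = u.1 ∧
      P.length + T.length = u.2 + 1 := by
  constructor
  · rintro ⟨h1, h2, h3⟩
    refine ⟨F.take u.1, frag F u.1 (u.2 + 1), F.drop (u.2 + 1), ?_, h3, ?_, ?_⟩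
    · have : F.take u.1 = (F.take (u.2 + 1)).take u.1 := by
        rw [List.take_take, min_eq_left (by omega)]
      rw [this, frag, List.take_append_drop, List.take_append_drop]
    · simp; omega
    · simp [frag]; omega
  · rintro ⟨P, T, S, rfl, hT, h1, h2⟩
    have hl : 2 ≤ T.length := by
      obtain ⟨a, f, -, rfl⟩ := hT
      simp
    refine ⟨by omega, by simp; omega, ?_⟩
    have : frag (P ++ T ++ S) u.1 (u.2 + 1) = T := by
      rw [frag, ← h1, ← h2, List.take_left' (by simp), List.drop_left]
    rwa [this]

theorem IsNode.lt {F : List (Paren α)} {u : ℕ × ℕ} (h : IsNode F u) : u.1 < u.2 := h.1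

theorem IsNode.lt_length {F : List (Paren α)} {u : ℕ × ℕ} (h : IsNode F u) :
    u.2 < F.length := h.2.1

theorem IsNode.getElem?_fst {F : List (Paren α)} {u : ℕ × ℕ} (h : IsNode F u) :
    ∃ a, F[u.1]? = some (Paren.op a) := by
  obtain ⟨P, T, S, rfl, ⟨a, f, -, rfl⟩, h1, h2⟩ := isNode_iff.1 h
  exact ⟨a, by simp [← h1]⟩

theorem IsNode.getElem?_snd {F : List (Paren α)} {u : ℕ × ℕ} (h : IsNode F u) :
    ∃ a, F[u.2]? = some (Paren.cl a) := by
  obtain ⟨P, T, S, rfl, ⟨a, f, -, rfl⟩, h1, h2⟩ := isNode_iff.1 h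
  refine ⟨a, ?_⟩
  have : u.2 = P.length + (f.length + 1) := by simp at h2; omega
  rw [this]
  simp

/-- A tree inside a string is a node. -/
theorem isNode_of_tree (P S : List (Paren α)) {T : List (Paren α)} (hT : IsTree T) {i j : ℕ}
    (hi : P.length = i) (hj : P.length + T.length = j + 1) : IsNode (P ++ T ++ S) (i, j) :=
  isNode_iff.2 ⟨P, T, S, rfl, hT, hi, hj⟩

theorem IsNode.embed {s : List (Paren α)} {i j : ℕ} (h : IsNode s (i, j))
    (P S : List (Paren α)) : IsNode (P ++ s ++ S) (P.length + i, P.length + j) := by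
  obtain ⟨P', T, S', rfl, hT, h1, h2⟩ := isNode_iff.1 h
  refine isNode_iff.2 ⟨P ++ P', T, S' ++ S, by simp, hT, ?_, ?_⟩ <;> (simp_all; try omega)

theorem frag_append {s P S : List (Paren α)} {i j : ℕ} (hj : j ≤ s.length) :
    frag (P ++ s ++ S) (P.length + i) (P.length + j) = frag s i j := by
  simp only [frag]
  rw [List.append_assoc, List.take_length_add_append, List.drop_length_add_append,
    List.take_append_of_le_length hj]

theorem IsNode.restrict {P s S : List (Paren α)} {i j : ℕ}
    (h : IsNode (P ++ s ++ S) (P.length + i, P.length + j)) (hj : j < s.length) :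
    IsNode s (i, j) := by
  refine ⟨by have := h.1; simp at this; exact this, hj, ?_⟩
  have := h.2.2
  simp only at this
  rwa [add_assoc, frag_append (by omega)] at this

/-- Nodes survive the insertion of a forest. -/
theorem IsNode.insert {s t c : List (Paren α)} {i j : ℕ} (h : IsNode (s ++ t) (i, j))
    (hc : IsForest c) :
    IsNode (s ++ c ++ t) (if i < s.length then i else i + c.length,
      if j < s.length then j else j + c.length) := by
  have hij : i < j := h.lt
  have hjl : j < (s ++ t).length := h.lt_length
  simp only [List.length_append] at hjl
  by_cases hj : j < s.length
  · have h' : IsNode s (i, j) := IsNode.restrict (P := []) (S := t) (by simpa using h) hj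
    have := h'.embed [] (c ++ t)
    simpa [hj, hij.trans hj] using this
  by_cases hi : s.length ≤ i
  · obtain ⟨i, rfl⟩ := Nat.exists_eq_add_of_le hi
    obtain ⟨j, rfl⟩ := Nat.exists_eq_add_of_le (hi.trans hij.le)
    have h' : IsNode t (i, j) :=
      IsNode.restrict (P := s) (S := []) (by simpa using h) (by omega)
    have := h'.embed (s ++ c) []
    simp only [List.append_nil, List.length_append] at this
    simp only [not_lt.2 (Nat.le_add_right s.length _), if_false]
    convert this using 2 <;> ring
  · rw [if_pos (by omega), if_neg hj]
    push Not at hi hj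
    obtain ⟨-, -, hT⟩ := h
    simp only [frag] at hT
    rw [List.take_append, List.drop_append,
      List.take_of_length_le (by omega)] at hT
    have e : (s ++ c ++ t) = s.take i ++ (s.drop i ++ c ++ t.take (j + 1 - s.length))
        ++ t.drop (j + 1 - s.length) := by
      simp only [List.append_assoc, List.take_append_drop]
      rw [← List.append_assoc (s.take i), List.take_append_drop]
    rw [e]
    refine isNode_of_tree _ _ ?_ (by simp; omega) (by simp; omega)
    rw [Nat.sub_eq_zero_of_le hi.le, List.drop_zero] at hT
    exact IsTree.replace (c := []) (by simpa using hT)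
      (List.ne_nil_of_length_pos (by rw [List.length_drop]; omega))
      (List.ne_nil_of_length_pos (by rw [List.length_take]; omega)) IsForest.nil hc

/-- Nodes with no end in a forest survive the removal of the forest. -/
theorem IsNode.remove {s t c : List (Paren α)} {i j : ℕ} (h : IsNode (s ++ c ++ t) (i, j))
    (hc : IsForest c) (hi : i < s.length ∨ s.length + c.length ≤ i)
    (hj : j < s.length ∨ s.length + c.length ≤ j) :
    IsNode (s ++ t) (if i < s.length then i else i - c.length,
      if j < s.length then j else j - c.length) := by
  have hij : i < j := h.lt
  have hjl : j < (s ++ c ++ t).length := h.lt_length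
  simp only [List.length_append] at hjl
  by_cases hj' : j < s.length
  · have h' : IsNode s (i, j) := IsNode.restrict (P := []) (S := c ++ t) (by simpa using h) hj'
    have := h'.embed [] t
    simpa [hj', hij.trans hj'] using this
  replace hj := hj.resolve_left hj'
  by_cases hi' : s.length + c.length ≤ i
  · obtain ⟨i, rfl⟩ := Nat.exists_eq_add_of_le hi'
    obtain ⟨j, rfl⟩ := Nat.exists_eq_add_of_le hj
    have h' : IsNode t (i, j) :=
      IsNode.restrict (P := s ++ c) (S := []) (by simpa using h) (by omega)
    have := h'.embed s []
    rw [if_neg (by omega), if_neg (by omega)]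
    rw [List.append_nil] at this
    convert this using 2 <;> omega
  · replace hi := hi.resolve_right hi'
    rw [if_pos hi, if_neg hj']
    obtain ⟨-, -, hT⟩ := h
    simp only [frag] at hT
    rw [List.take_append, List.take_of_length_le (by simp; omega), List.append_assoc,
      List.drop_append, Nat.sub_eq_zero_of_le hi.le, List.drop_zero, ← List.append_assoc] at hT
    have e : (s ++ t) = s.take i ++ (s.drop i ++ [] ++ t.take (j + 1 - (s ++ c).length))
        ++ t.drop (j + 1 - (s ++ c).length) := by
      simp only [List.append_nil, List.append_assoc, List.take_append_drop]
      rw [← List.append_assoc (s.take i), List.take_append_drop]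
    rw [e]
    refine isNode_of_tree _ _ ?_ (by simp; omega) (by simp; omega)
    exact IsTree.replace hT
      (List.ne_nil_of_length_pos (by rw [List.length_drop]; omega))
      (List.ne_nil_of_length_pos (by rw [List.length_take, List.length_append]; omega))
      hc IsForest.nil

/-- Prefix heights stay strictly above the initial level throughout a node and return to it right
after the node. This is what prevents nodes from crossing each other or the boundary of a balanced
fragment. -/
theorem IsNode.height_lt {F : List (Paren α)} {u : ℕ × ℕ} (h : IsNode F u) {n : ℕ}
    (h1 : u.1 < n) (h2 : n ≤ u.2) : height (F.take u.1) < height (F.take n) := by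
  obtain ⟨P, T, S, rfl, hT, h3, h4⟩ := isNode_iff.1 h
  obtain ⟨m, rfl⟩ := Nat.exists_eq_add_of_le h1.le
  rw [← h3, List.append_assoc, List.take_left' rfl, List.take_length_add_append, height_append,
    List.take_append_of_le_length (by omega)]
  have := hT.height_take (n := m) (by omega) (by omega)
  omega

theorem IsNode.height_eq {F : List (Paren α)} {u : ℕ × ℕ} (h : IsNode F u) :
    height (F.take (u.2 + 1)) = height (F.take u.1) := by
  obtain ⟨P, T, S, rfl, hT, h3, h4⟩ := isNode_iff.1 h
  rw [← h4, ← h3, List.append_assoc, List.take_left' rfl, List.take_length_add_append,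
    height_append, List.take_left' rfl, hT.isForest.height_eq, add_zero]

/-- Nodes do not cross. -/
theorem IsNode.snd_lt_snd {F : List (Paren α)} {u v : ℕ × ℕ} (hu : IsNode F u)
    (hv : IsNode F v) (h1 : u.1 < v.1) (h2 : v.1 ≤ u.2) : v.2 < u.2 := by
  by_contra! h
  have h3 := hu.height_lt h1 h2
  have h4 := hu.height_eq
  rcases h.lt_or_eq with h | h
  · have := hv.height_lt (n := u.2 + 1) (by omega) (by omega)
    omega
  · have := hv.height_eq
    rw [← h] at this
    omega

theorem IsNode.snd_le_snd {F : List (Paren α)} {u v : ℕ × ℕ} (hu : IsNode F u)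
    (hv : IsNode F v) (h1 : u.1 = v.1) : v.2 ≤ u.2 := by
  by_contra! h
  have := hv.height_lt (n := u.2 + 1) (by have := hu.lt; omega) (by omega)
  have := hu.height_eq
  rw [h1] at this
  omega

/-- A node has either both ends or no end in a given balanced fragment. -/
theorem IsNode.mem_forest_iff {s c t : List (Paren α)} {i j : ℕ}
    (h : IsNode (s ++ c ++ t) (i, j)) (hc : IsForest c) :
    (s.length ≤ i ∧ i < s.length + c.length) ↔ (s.length ≤ j ∧ j < s.length + c.length) := by
  have hij : i < j := h.lt
  have key : ∀ n, n ≤ c.length → height ((s ++ c ++ t).take (s.length + n)) =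
      height s + height (c.take n) := by
    intro n hn
    rw [List.append_assoc, List.take_length_add_append, List.take_append_of_le_length hn,
      height_append]
  have hend : height ((s ++ c ++ t).take (s.length + c.length)) = height s := by
    rw [key _ le_rfl, List.take_length, hc.height_eq, add_zero]
  have hge : ∀ n, s.length ≤ n → n ≤ s.length + c.length →
      height s ≤ height ((s ++ c ++ t).take n) := by
    intro n h1 h2
    obtain ⟨n, rfl⟩ := Nat.exists_eq_add_of_le h1
    rw [key n (by omega)]
    have := hc.height_take n
    omega
  constructor
  · rintro ⟨h1, h2⟩
    refine ⟨by omega, ?_⟩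
    -- A node reaching beyond the fragment would force the height at the end of `c` above the height
    -- at `i`, but `c` ends at its minimal level.
    by_contra! h3
    have := h.height_lt h2 h3
    have := hge i h1 (by omega)
    simp only at *
    omega
  · rintro ⟨h1, h2⟩
    refine ⟨?_, by omega⟩
    by_contra! h3
    have h4 := h.height_lt h3 h1
    have h5 := hge (j + 1) (by omega) (by omega)
    have h6 := h.height_eq
    have h7 : height ((s ++ c ++ t).take s.length) = height s := by
      rw [List.append_assoc, List.take_left' rfl]
    simp only at h4 h6
    omega

/-- Every position of a forest belongs to a node. -/
theorem IsForest.exists_node {F : List (Paren α)} (h : IsForest F) :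
    ∀ x < F.length, ∃ u, IsNode F u ∧ (u.1 = x ∨ u.2 = x) := by
  induction h with
  | nil => intro x hx; simp at hx
  | @append F G hF hG h₁ h₂ =>
    intro x hx
    by_cases hxF : x < F.length
    · obtain ⟨⟨i, j⟩, hu, h⟩ := h₁ x hxF
      exact ⟨_, by simpa using hu.embed [] G, h⟩
    · push Not at hxF
      obtain ⟨x, rfl⟩ := Nat.exists_eq_add_of_le hxF
      obtain ⟨⟨i, j⟩, hu, h⟩ := h₂ x (by simp at hx; omega)
      refine ⟨_, by simpa using hu.embed F [], ?_⟩
      simpa using h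
  | @wrap F a hF h =>
    intro x hx
    have root : IsNode ([Paren.op a] ++ F ++ [Paren.cl a]) (0, F.length + 1) := by
      simpa using isNode_of_tree [] [] ⟨a, F, hF, rfl⟩ (i := 0) (j := F.length + 1)
        (by simp) (by simp)
    cases x with
    | zero => exact ⟨_, root, Or.inl rfl⟩
    | succ x =>
      by_cases hxF : x < F.length
      · obtain ⟨⟨i, j⟩, hu, h⟩ := h x hxF
        refine ⟨_, hu.embed [Paren.op a] [Paren.cl a], ?_⟩
        simp at h ⊢
        omega
      · refine ⟨_, root, Or.inr ?_⟩
        simp at hx ⊢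
        omega

/-! ### Alignments as lists of columns -/

/-- A column of an alignment. -/
inductive Col (β : Type*) where
  | del (a : β) : Col β
  | ins (b : β) : Col β
  | sub (a b : β) : Col β

namespace Col

def fst : Col β → Option β
  | del a => some a
  | ins _ => none
  | sub a _ => some a

def snd : Col β → Option β
  | del _ => none
  | ins b => some b
  | sub _ b => some b

/-- The endpoint of the step described by a column. -/
def next (p : ℕ × ℕ) : Col β → ℕ × ℕ
  | del _ => (p.1 + 1, p.2)
  | ins _ => (p.1, p.2 + 1)
  | sub _ _ => (p.1 + 1, p.2 + 1)

end Col

/-- The first row of a list of columns. -/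
def top (s : List (Col β)) : List β := s.filterMap Col.fst

/-- The second row of a list of columns. -/
def bot (s : List (Col β)) : List β := s.filterMap Col.snd

/-- The columns of the identical alignment of `L`. -/
def diag (L : List β) : List (Col β) := L.map fun p => Col.sub p p

@[simp] theorem top_nil : top ([] : List (Col β)) = [] := rfl
@[simp] theorem bot_nil : bot ([] : List (Col β)) = [] := rfl

@[simp] theorem top_append (s t : List (Col β)) : top (s ++ t) = top s ++ top t := by
  simp [top]

@[simp] theorem bot_append (s t : List (Col β)) : bot (s ++ t) = bot s ++ bot t := by
  simp [bot]

@[simp] theorem top_del (a : β) (s : List (Col β)) : top (.del a :: s) = a :: top s := rfl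
@[simp] theorem top_ins (a : β) (s : List (Col β)) : top (.ins a :: s) = top s := rfl
@[simp] theorem top_sub (a b : β) (s : List (Col β)) : top (.sub a b :: s) = a :: top s := rfl
@[simp] theorem bot_del (a : β) (s : List (Col β)) : bot (.del a :: s) = bot s := rfl
@[simp] theorem bot_ins (a : β) (s : List (Col β)) : bot (.ins a :: s) = a :: bot s := rfl
@[simp] theorem bot_sub (a b : β) (s : List (Col β)) : bot (.sub a b :: s) = b :: bot s := rfl

@[simp] theorem top_diag (L : List β) : top (diag L) = L := by
  induction L with
  | nil => rfl
  | cons p L ih => simpa [diag] using ih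

@[simp] theorem bot_diag (L : List β) : bot (diag L) = L := by
  induction L with
  | nil => rfl
  | cons p L ih => simpa [diag] using ih

/-- The position `x` of the first row lies in a deletion column. -/
def Del (s : List (Col β)) (x : ℕ) : Prop :=
  ∃ s₁ p s₂, s = s₁ ++ Col.del p :: s₂ ∧ x = (top s₁).length

/-- The positions `x` of the first row and `y` of the second row share a column. -/
def Al (s : List (Col β)) (x y : ℕ) : Prop :=
  ∃ s₁ p q s₂, s = s₁ ++ Col.sub p q :: s₂ ∧ x = (top s₁).length ∧ y = (bot s₁).length

theorem del_cons {c : Col β} {s : List (Col β)} {x : ℕ} :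
    Del (c :: s) x ↔ (x = 0 ∧ ∃ p, c = .del p) ∨ ∃ x', Del s x' ∧ x = x' + (top [c]).length := by
  constructor
  · rintro ⟨s₁, p, s₂, h, hx⟩
    cases s₁ with
    | nil =>
      simp at h
      exact Or.inl ⟨by simpa using hx, p, h.1⟩
    | cons d s₁ =>
      simp at h
      obtain ⟨rfl, rfl⟩ := h
      refine Or.inr ⟨_, ⟨s₁, p, s₂, rfl, rfl⟩, ?_⟩
      rw [hx, ← List.singleton_append, top_append, List.length_append]
      ring
  · rintro (⟨rfl, p, rfl⟩ | ⟨x', ⟨s₁, p, s₂, rfl, rfl⟩, rfl⟩)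
    · exact ⟨[], p, s, rfl, rfl⟩
    · refine ⟨c :: s₁, p, s₂, by simp, ?_⟩
      rw [← List.singleton_append (l := s₁), top_append, List.length_append]
      ring

theorem al_cons {c : Col β} {s : List (Col β)} {x y : ℕ} :
    Al (c :: s) x y ↔ (x = 0 ∧ y = 0 ∧ ∃ p q, c = .sub p q) ∨
      ∃ x' y', Al s x' y' ∧ x = x' + (top [c]).length ∧ y = y' + (bot [c]).length := by
  constructor
  · rintro ⟨s₁, p, q, s₂, h, hx, hy⟩
    cases s₁ with
    | nil =>
      simp at h
      exact Or.inl ⟨by simpa using hx, by simpa using hy, p, q, h.1⟩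
    | cons d s₁ =>
      simp at h
      obtain ⟨rfl, rfl⟩ := h
      refine Or.inr ⟨_, _, ⟨s₁, p, q, s₂, rfl, rfl, rfl⟩, ?_, ?_⟩
      · rw [hx, ← List.singleton_append, top_append, List.length_append]
        ring
      · rw [hy, ← List.singleton_append, bot_append, List.length_append]
        ring
  · rintro (⟨rfl, rfl, p, q, rfl⟩ | ⟨x', y', ⟨s₁, p, q, s₂, rfl, rfl, rfl⟩, rfl, rfl⟩)
    · exact ⟨[], p, q, s, rfl, rfl, rfl⟩
    · refine ⟨c :: s₁, p, q, s₂, by simp, ?_, ?_⟩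
      · rw [← List.singleton_append (l := s₁), top_append, List.length_append]
        ring
      · rw [← List.singleton_append (l := s₁), bot_append, List.length_append]
        ring

theorem Del.lt {s : List (Col β)} {x : ℕ} (h : Del s x) : x < (top s).length := by
  obtain ⟨s₁, p, s₂, rfl, rfl⟩ := h
  simp

theorem Al.lt {s : List (Col β)} {x y : ℕ} (h : Al s x y) :
    x < (top s).length ∧ y < (bot s).length := by
  obtain ⟨s₁, p, q, s₂, rfl, rfl, rfl⟩ := h
  simp

theorem not_del_nil {x : ℕ} : ¬ Del ([] : List (Col β)) x := fun h => by simpa using h.lt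

theorem not_al_nil {x y : ℕ} : ¬ Al ([] : List (Col β)) x y := fun h => by simpa using h.lt

theorem del_append {s t : List (Col β)} : ∀ {x : ℕ},
    Del (s ++ t) x ↔ Del s x ∨ ∃ x', Del t x' ∧ x = (top s).length + x' := by
  induction s with
  | nil => intro x; simp [not_del_nil]
  | cons c s ih =>
    intro x
    have e : (top (c :: s)).length = (top [c]).length + (top s).length := by
      rw [← List.singleton_append, top_append, List.length_append]
    rw [List.cons_append, del_cons, del_cons, e]
    constructor
    · rintro (h | ⟨x', h, rfl⟩)
      · exact Or.inl (Or.inl h)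
      · rcases ih.1 h with h' | ⟨x'', h', rfl⟩
        · exact Or.inl (Or.inr ⟨x', h', rfl⟩)
        · exact Or.inr ⟨x'', h', by ring⟩
    · rintro ((h | ⟨x', h, rfl⟩) | ⟨x', h, rfl⟩)
      · exact Or.inl h
      · exact Or.inr ⟨x', ih.2 (Or.inl h), rfl⟩
      · exact Or.inr ⟨_, ih.2 (Or.inr ⟨x', h, rfl⟩), by ring⟩

theorem al_append {s t : List (Col β)} : ∀ {x y : ℕ},
    Al (s ++ t) x y ↔ Al s x y ∨
      ∃ x' y', Al t x' y' ∧ x = (top s).length + x' ∧ y = (bot s).length + y' := by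
  induction s with
  | nil => intro x y; simp [not_al_nil]
  | cons c s ih =>
    intro x y
    have e : (top (c :: s)).length = (top [c]).length + (top s).length := by
      rw [← List.singleton_append, top_append, List.length_append]
    have e' : (bot (c :: s)).length = (bot [c]).length + (bot s).length := by
      rw [← List.singleton_append, bot_append, List.length_append]
    rw [List.cons_append, al_cons, al_cons, e, e']
    constructor
    · rintro (h | ⟨x', y', h, rfl, rfl⟩)
      · exact Or.inl (Or.inl h)
      · rcases ih.1 h with h' | ⟨x'', y'', h', rfl, rfl⟩
        · exact Or.inl (Or.inr ⟨x', y', h', rfl, rfl⟩)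
        · exact Or.inr ⟨x'', y'', h', by ring, by ring⟩
    · rintro ((h | ⟨x', y', h, rfl, rfl⟩) | ⟨x', y', h, rfl, rfl⟩)
      · exact Or.inl h
      · exact Or.inr ⟨x', y', ih.2 (Or.inl h), rfl, rfl⟩
      · exact Or.inr ⟨_, _, ih.2 (Or.inr ⟨x', y', h, rfl, rfl⟩), by ring, by ring⟩

theorem not_del_diag {L : List β} {x : ℕ} : ¬ Del (diag L) x := by
  rintro ⟨s₁, p, s₂, h, -⟩
  have : Col.del p ∈ diag L := by rw [h]; simp
  simp [diag] at this

theorem al_diag {L : List β} : ∀ {x y : ℕ}, Al (diag L) x y ↔ x = y ∧ x < L.length := by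
  induction L with
  | nil => intro x y; simp [diag, not_al_nil]
  | cons p L ih =>
    intro x y
    have : diag (p :: L) = .sub p p :: diag L := rfl
    rw [this, al_cons]
    simp only [ih]
    constructor
    · rintro (⟨rfl, rfl, -⟩ | ⟨x', y', ⟨rfl, h⟩, rfl, rfl⟩) <;> simp
      exact h
    · rintro ⟨rfl, h⟩
      cases x with
      | zero => exact Or.inl ⟨rfl, rfl, p, p, rfl⟩
      | succ x => exact Or.inr ⟨x, x, ⟨rfl, by simpa using h⟩, rfl, rfl⟩

/-- Forest alignments in column form. -/
def ForestCols (s : List (Col (Paren α))) : Prop :=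
  ∀ u : ℕ × ℕ, IsNode (top s) u →
    (Del s u.1 ∧ Del s u.2) ∨ ∃ v : ℕ × ℕ, IsNode (bot s) v ∧ Al s u.1 v.1 ∧ Al s u.2 v.2

/-- The cost of a list of columns. -/
noncomputable def colCost (w : Option β → Option β → ℝ≥0∞) (s : List (Col β)) : ℝ≥0∞ :=
  (s.map fun c => w c.fst c.snd).sum

theorem colCost_append (w : Option β → Option β → ℝ≥0∞) (s t : List (Col β)) :
    colCost w (s ++ t) = colCost w s + colCost w t := by
  simp [colCost]

theorem colCost_diag (w : Option β → Option β → ℝ≥0∞) (hw : ∀ p, w p p = 0) (L : List β) :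
    colCost w (diag L) = 0 := by
  induction L with
  | nil => simp [colCost, diag]
  | cons p L ih => simpa [colCost, diag, Col.fst, Col.snd, hw] using ih

/-! ### Columns and sequences of pairs -/

/-- The sequence of pairs visited by a list of columns. -/
def trace : ℕ × ℕ → List (Col β) → List (ℕ × ℕ)
  | p, [] => [p]
  | p, c :: s => p :: trace (c.next p) s

theorem trace_head? (p : ℕ × ℕ) (s : List (Col β)) : (trace p s).head? = some p := by
  cases s <;> rfl

theorem trace_ne_nil (p : ℕ × ℕ) (s : List (Col β)) : trace p s ≠ [] := by
  cases s <;> simp [trace]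

theorem trace_getLast? (s : List (Col β)) : ∀ p : ℕ × ℕ,
    (trace p s).getLast? = some (p.1 + (top s).length, p.2 + (bot s).length) := by
  induction s with
  | nil => intro p; rfl
  | cons c s ih =>
    intro p
    obtain ⟨q, r, h⟩ := List.exists_cons_of_ne_nil (trace_ne_nil (c.next p) s)
    rw [trace, h, List.getLast?_cons_cons, ← h, ih]
    cases c <;> simp [Col.next] <;> omega

theorem step_next (p : ℕ × ℕ) (c : Col β) : Step p (c.next p) := by
  cases c <;> simp [Step, Col.next]

theorem trace_isChain (s : List (Col β)) : ∀ p : ℕ × ℕ, (trace p s).IsChain Step := by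
  induction s with
  | nil => intro p; simp [trace]
  | cons c s ih =>
    intro p
    have := ih (c.next p)
    cases s with
    | nil => simpa [trace] using step_next p c
    | cons d s =>
      rw [trace, trace, List.isChain_cons_cons]
      exact ⟨step_next p c, this⟩

theorem isAlignment_trace (s : List (Col β)) :
    IsAlignment (trace (0, 0) s) (top s) (bot s) :=
  ⟨trace_head? _ _, by simpa using trace_getLast? s (0, 0), trace_isChain s _⟩

theorem edCost_trace (w : Option β → Option β → ℝ≥0∞) (X Y : List β) (s : List (Col β)) :
    ∀ p : ℕ × ℕ, X.drop p.1 = top s → Y.drop p.2 = bot s →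
      edCost w X Y (trace p s) = colCost w s := by
  induction s with
  | nil => intro p _ _; simp [trace, edCost, colCost]
  | cons c s ih =>
    intro p hX hY
    obtain ⟨r, hr⟩ : ∃ r, trace (c.next p) s = c.next p :: r := by
      cases s <;> exact ⟨_, rfl⟩
    rw [trace, hr, edCost, ← hr]
    have get : ∀ (Z : List β) (n : ℕ) (a : β) (t : List β), Z.drop n = a :: t →
        Z[n]? = some a ∧ Z.drop (n + 1) = t := by
      intro Z n a t h
      constructor
      · rw [← Nat.add_zero n, ← List.getElem?_drop, h]; rfl
      · rw [← List.drop_drop, h]; rfl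
    cases c with
    | del a =>
      rw [top_del] at hX
      obtain ⟨h1, h2⟩ := get X _ _ _ hX
      rw [ih (Col.next p (.del a)) h2 hY]
      simp [stepCost, Col.next, h1, colCost, Col.fst, Col.snd]
    | ins b =>
      rw [bot_ins] at hY
      obtain ⟨h1, h2⟩ := get Y _ _ _ hY
      rw [ih (Col.next p (.ins b)) hX h2]
      simp [stepCost, Col.next, h1, colCost, Col.fst, Col.snd]
    | sub a b =>
      rw [top_sub] at hX
      rw [bot_sub] at hY
      obtain ⟨h1, h2⟩ := get X _ _ _ hX
      obtain ⟨h3, h4⟩ := get Y _ _ _ hY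
      rw [ih (Col.next p (.sub a b)) h2 h4]
      simp [stepCost, Col.next, h1, h3, colCost, Col.fst, Col.snd]

/-- The bounds on `p` are proved simultaneously, from the last pair backwards; they guarantee that
the letters placed in the columns exist. -/
theorem IsChain.exists_cols (X Y : List β) (A : List (ℕ × ℕ)) : ∀ p : ℕ × ℕ,
    (p :: A).IsChain Step → (p :: A).getLast? = some (X.length, Y.length) →
      p.1 ≤ X.length ∧ p.2 ≤ Y.length ∧
      ∃ s : List (Col β), p :: A = trace p s ∧ top s = X.drop p.1 ∧ bot s = Y.drop p.2 := by
  induction A with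
  | nil =>
    intro p _ h
    simp at h
    subst h
    exact ⟨le_rfl, le_rfl, [], rfl, by simp, by simp⟩
  | cons q A ih =>
    intro p hc hl
    rw [List.isChain_cons_cons] at hc
    rw [List.getLast?_cons_cons] at hl
    obtain ⟨h1, h2, s, hs, hX, hY⟩ := ih q hc.2 hl
    rcases hc.1 with rfl | rfl | rfl
    · simp only at h1 h2 hX hY
      refine ⟨by omega, by omega, .sub X[p.1] Y[p.2] :: s, by rw [trace, hs]; rfl, ?_, ?_⟩
      · rw [top_sub, hX, List.cons_getElem_drop_succ]
      · rw [bot_sub, hY, List.cons_getElem_drop_succ]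
    · simp only at h1 h2 hX hY
      refine ⟨by omega, by omega, .del X[p.1] :: s, by rw [trace, hs]; rfl, ?_, ?_⟩
      · rw [top_del, hX, List.cons_getElem_drop_succ]
      · rw [bot_del, hY]
    · simp only at h1 h2 hX hY
      refine ⟨by omega, by omega, .ins Y[p.2] :: s, by rw [trace, hs]; rfl, ?_, ?_⟩
      · rw [top_ins, hX]
      · rw [bot_ins, hY, List.cons_getElem_drop_succ]

theorem IsAlignment.exists_cols {A : List (ℕ × ℕ)} {X Y : List β} (h : IsAlignment A X Y) :
    ∃ s : List (Col β), A = trace (0, 0) s ∧ top s = X ∧ bot s = Y := by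
  obtain ⟨h1, h2, h3⟩ := h
  cases A with
  | nil => simp at h1
  | cons p A =>
    simp at h1
    subst h1
    obtain ⟨-, -, s, hs, hX, hY⟩ := IsChain.exists_cols X Y A _ h3 h2
    exact ⟨s, hs, by simpa using hX, by simpa using hY⟩

theorem pair_infix_trace {P Q : ℕ × ℕ} (s : List (Col β)) : ∀ p : ℕ × ℕ,
    [P, Q] <:+: trace p s ↔ ∃ s₁ c s₂, s = s₁ ++ c :: s₂ ∧
      P = (p.1 + (top s₁).length, p.2 + (bot s₁).length) ∧ Q = Col.next P c := by
  induction s with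
  | nil =>
    intro p
    simp [trace, List.infix_cons_iff]
  | cons c s ih =>
    intro p
    have hp : [P, Q] <+: p :: trace (c.next p) s ↔ P = p ∧ Q = c.next p := by
      obtain ⟨r, hr⟩ : ∃ r, trace (c.next p) s = c.next p :: r := by
        cases s <;> exact ⟨_, rfl⟩
      rw [hr]
      simp
    rw [trace, List.infix_cons_iff, hp, ih]
    have hn : ∀ t : List (Col β), ((c.next p).1 + (top t).length, (c.next p).2 + (bot t).length)
        = (p.1 + (top (c :: t)).length, p.2 + (bot (c :: t)).length) := by
      intro t
      cases c <;> simp [Col.next] <;> omega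
    constructor
    · rintro (⟨rfl, rfl⟩ | ⟨s₁, d, s₂, rfl, rfl, rfl⟩)
      · exact ⟨[], c, s, rfl, by simp, rfl⟩
      · exact ⟨c :: s₁, d, s₂, rfl, hn _, rfl⟩
    · rintro ⟨s₁, d, s₂, h, rfl, rfl⟩
      cases s₁ with
      | nil =>
        simp at h
        obtain ⟨rfl, rfl⟩ := h
        exact Or.inl ⟨by simp, by simp⟩
      | cons d' s₁ =>
        simp at h
        obtain ⟨rfl, rfl⟩ := h
        exact Or.inr ⟨s₁, d, s₂, rfl, (hn _).symm, rfl⟩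

theorem deletes_trace {s : List (Col β)} {x : ℕ} : Deletes (trace (0, 0) s) x ↔ Del s x := by
  simp only [Deletes, pair_infix_trace]
  constructor
  · rintro ⟨y, s₁, c, s₂, rfl, h1, h2⟩
    simp at h1
    cases c with
    | del p => exact ⟨s₁, p, s₂, rfl, h1.1⟩
    | ins p => simp [Col.next] at h2
    | sub p q => simp [Col.next] at h2
  · rintro ⟨s₁, p, s₂, rfl, rfl⟩
    exact ⟨_, s₁, .del p, s₂, rfl, by simp; rfl, rfl⟩

theorem aligns_trace {s : List (Col β)} {x y : ℕ} :
    Aligns (trace (0, 0) s) x y ↔ Al s x y := by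
  simp only [Aligns, pair_infix_trace]
  constructor
  · rintro ⟨s₁, c, s₂, rfl, h1, h2⟩
    simp at h1
    cases c with
    | del p => simp [Col.next] at h2
    | ins p => simp [Col.next] at h2
    | sub p q => exact ⟨s₁, p, q, s₂, rfl, h1.1, h1.2⟩
  · rintro ⟨s₁, p, q, s₂, rfl, rfl, rfl⟩
    exact ⟨s₁, .sub p q, s₂, rfl, by simp, rfl⟩

theorem isForestAlignment_trace {s : List (Col (Paren α))} :
    IsForestAlignment (trace (0, 0) s) (top s) (bot s) ↔ ForestCols s := by
  simp only [IsForestAlignment, isAlignment_trace, true_and, ForestCols, deletes_trace,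
    aligns_trace]

theorem ted_le {w : Option α → Option α → ℝ≥0∞} {s : List (Col (Paren α))}
    (h : ForestCols s) : ted w (top s) (bot s) ≤ colCost (parenWeight w) s / 2 := by
  unfold ted
  refine iInf_le_of_le (trace (0, 0) s) (iInf_le_of_le (isForestAlignment_trace.2 h) ?_)
  rw [tedCost, edCost_trace _ _ _ _ _ (by simp) (by simp)]

/-- With a strict bound, an alignment is obtained directly from the infimum, and attainment is never
needed. -/
theorem exists_cols_of_ted_lt {w : Option α → Option α → ℝ≥0∞} {F G : List (Paren α)}
    {r : ℝ≥0∞} (h : ted w F G < r) : ∃ s : List (Col (Paren α)), top s = F ∧ bot s = G ∧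
      ForestCols s ∧ colCost (parenWeight w) s / 2 < r := by
  simp only [ted, iInf_lt_iff] at h
  obtain ⟨A, hA, hr⟩ := h
  obtain ⟨s, rfl, rfl, rfl⟩ := hA.1.exists_cols
  refine ⟨s, rfl, rfl, isForestAlignment_trace.1 hA, ?_⟩
  rwa [tedCost, edCost_trace _ _ _ _ _ (by simp) (by simp)] at hr

/-! ### Replacing an identically aligned context -/

/-- The position of `x` after the insertion of `n` characters at position `m`. -/
def shift (m n x : ℕ) : ℕ := if x < m then x else x + n

theorem exists_shift {m n x : ℕ} (h : ¬ (m ≤ x ∧ x < m + n)) : ∃ y, x = shift m n y := by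
  by_cases hx : x < m
  · exact ⟨x, by simp [shift, hx]⟩
  · exact ⟨x - n, by rw [shift, if_neg (by omega)]; omega⟩

theorem IsNode.insert_shift {s t c : List (Paren α)} {i j : ℕ} (h : IsNode (s ++ t) (i, j))
    (hc : IsForest c) :
    IsNode (s ++ c ++ t) (shift s.length c.length i, shift s.length c.length j) :=
  h.insert hc

theorem IsNode.remove_shift {s t c : List (Paren α)} {i j : ℕ}
    (h : IsNode (s ++ c ++ t) (shift s.length c.length i, shift s.length c.length j))
    (hc : IsForest c) : IsNode (s ++ t) (i, j) := by
  have key : ∀ i, shift s.length c.length i < s.length ∨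
      s.length + c.length ≤ shift s.length c.length i := by
    intro i; unfold shift; split_ifs <;> omega
  have key' : ∀ i, (if shift s.length c.length i < s.length then shift s.length c.length i
      else shift s.length c.length i - c.length) = i := by
    intro i; unfold shift; split_ifs <;> omega
  have := h.remove hc (key i) (key j)
  rwa [key', key'] at this

theorem del_shift {a w e : List (Col β)} {x : ℕ} :
    Del (a ++ w ++ e) (shift (top a).length (top w).length x) ↔ Del (a ++ e) x := by
  simp only [del_append]
  unfold shift
  split_ifs with hx
  · constructor
    · rintro ((h | ⟨x', h, h'⟩) | ⟨x', h, h'⟩)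
      · exact Or.inl h
      · omega
      · simp at h'; omega
    · rintro (h | ⟨x', h, h'⟩)
      · exact Or.inl (Or.inl h)
      · omega
  · constructor
    · rintro ((h | ⟨x', h, h'⟩) | ⟨x', h, h'⟩)
      · have := h.lt; omega
      · have := h.lt; omega
      · exact Or.inr ⟨x', h, by simp at h'; omega⟩
    · rintro (h | ⟨x', h, h'⟩)
      · have := h.lt; omega
      · exact Or.inr ⟨x', h, by simp; omega⟩

theorem Al.of_shift {a w e : List (Col β)} {x y : ℕ}
    (h : Al (a ++ w ++ e) (shift (top a).length (top w).length x) y) :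
    ∃ y', y = shift (bot a).length (bot w).length y' ∧ Al (a ++ e) x y' := by
  simp only [al_append] at h ⊢
  unfold shift at h ⊢
  split_ifs at h with hx
  · rcases h with (h | ⟨x', y', h, h', -⟩) | ⟨x', y', h, h', -⟩
    · exact ⟨y, by rw [if_pos h.lt.2], Or.inl h⟩
    · omega
    · simp at h'; omega
  · rcases h with (h | ⟨x', y', h, h', -⟩) | ⟨x', y', h, h', h''⟩
    · have := h.lt; omega
    · have := h.lt; omega
    · refine ⟨(bot a).length + y', ?_, Or.inr ⟨x', y', h, ?_, rfl⟩⟩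
      · rw [if_neg (by omega), h'']; simp; omega
      · simp at h'; omega

theorem Al.shift {a w e : List (Col β)} {x y : ℕ} (h : Al (a ++ e) x y) :
    Al (a ++ w ++ e) (shift (top a).length (top w).length x)
      (shift (bot a).length (bot w).length y) := by
  simp only [al_append] at h ⊢
  unfold TreeEdit.shift
  rcases h with h | ⟨x', y', h, rfl, rfl⟩
  · rw [if_pos h.lt.1, if_pos h.lt.2]
    exact Or.inl (Or.inl h)
  · rw [if_neg (by omega), if_neg (by omega)]
    exact Or.inr ⟨x', y', h, by simp; omega, by simp; omega⟩

theorem del_middle {a w e : List (Col β)} {x : ℕ} (hx : x < (top w).length) :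
    Del (a ++ w ++ e) ((top a).length + x) ↔ Del w x := by
  simp only [del_append]
  constructor
  · rintro ((h | ⟨x', h, h'⟩) | ⟨x', h, h'⟩)
    · have := h.lt; omega
    · obtain rfl : x = x' := by omega
      exact h
    · simp at h'; omega
  · intro h
    exact Or.inl (Or.inr ⟨x, h, rfl⟩)

theorem al_middle {a w e : List (Col β)} {x y : ℕ} (hx : x < (top w).length) :
    Al (a ++ w ++ e) ((top a).length + x) y ↔ ∃ y', y = (bot a).length + y' ∧ Al w x y' := by
  simp only [al_append]
  constructor
  · rintro ((h | ⟨x', y', h, h', rfl⟩) | ⟨x', y', h, h', -⟩)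
    · have := h.lt; omega
    · obtain rfl : x = x' := by omega
      exact ⟨y', rfl, h⟩
    · simp at h'; omega
  · rintro ⟨y', rfl, h⟩
    exact Or.inl (Or.inr ⟨x, y', h, rfl, rfl⟩)

theorem IsForest.insert {s t c : List (Paren α)} (h : IsForest (s ++ t)) (hc : IsForest c) :
    IsForest (s ++ c ++ t) :=
  IsForest.replace (c := []) (by simpa using h) IsForest.nil hc

/-- In a forest alignment, an identically aligned context can be replaced by any other one. -/
theorem ForestCols.replace {a c e : List (Col (Paren α))} {B₁ D₁ B₂ D₂ : List (Paren α)}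
    (h : ForestCols (a ++ (diag B₁ ++ c ++ diag D₁) ++ e))
    (hc : IsForest (top c)) (hc' : IsForest (bot c))
    (h₁ : IsForest (B₁ ++ D₁)) (h₂ : IsForest (B₂ ++ D₂)) :
    ForestCols (a ++ (diag B₂ ++ c ++ diag D₂) ++ e) := by
  rintro ⟨i, j⟩ hu
  have tw : ∀ B D : List (Paren α), top (diag B ++ c ++ diag D) = B ++ top c ++ D := by simp
  have bw : ∀ B D : List (Paren α), bot (diag B ++ c ++ diag D) = B ++ bot c ++ D := by simp
  have w1 : IsForest (top (diag B₁ ++ c ++ diag D₁)) := by rw [tw]; exact h₁.insert hc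
  have w2 : IsForest (top (diag B₂ ++ c ++ diag D₂)) := by rw [tw]; exact h₂.insert hc
  have w1' : IsForest (bot (diag B₁ ++ c ++ diag D₁)) := by rw [bw]; exact h₁.insert hc'
  have w2' : IsForest (bot (diag B₂ ++ c ++ diag D₂)) := by rw [bw]; exact h₂.insert hc'
  rw [top_append, top_append] at hu
  -- A node of the new first row lies inside `c`, in the new context, or outside the whole window.
  -- The window and `top c` are balanced, so both ends always fall into the same case.
  by_cases hi : (top a).length ≤ i ∧
      i < (top a).length + (top (diag B₂ ++ c ++ diag D₂)).length
  · have hj := (hu.mem_forest_iff w2).1 hi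
    obtain ⟨i, rfl⟩ := Nat.exists_eq_add_of_le hi.1
    obtain ⟨j, rfl⟩ := Nat.exists_eq_add_of_le hj.1
    replace hi := Nat.lt_of_add_lt_add_left hi.2
    replace hj := Nat.lt_of_add_lt_add_left hj.2
    replace hu := hu.restrict hj
    simp only [del_middle hi, del_middle hj, al_middle hi, al_middle hj]
    rw [tw] at hu
    by_cases hi' : B₂.length ≤ i ∧ i < B₂.length + (top c).length
    · have hj' := (hu.mem_forest_iff hc).1 hi'
      obtain ⟨i, rfl⟩ := Nat.exists_eq_add_of_le hi'.1
      obtain ⟨j, rfl⟩ := Nat.exists_eq_add_of_le hj'.1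
      replace hi' := Nat.lt_of_add_lt_add_left hi'.2
      replace hj' := Nat.lt_of_add_lt_add_left hj'.2
      replace hu := hu.restrict hj'
      have hu1 := (hu.embed B₁ D₁).embed (top a) (top e)
      rw [← tw, ← top_append, ← top_append] at hu1
      have d2 : ∀ x < (top c).length, Del (diag B₂ ++ c ++ diag D₂) (B₂.length + x) ↔ Del c x := by
        intro x hx
        have := del_middle (a := diag B₂) (e := diag D₂) hx
        rwa [top_diag] at this
      have a2 : ∀ x < (top c).length, ∀ y, Al (diag B₂ ++ c ++ diag D₂) (B₂.length + x) y ↔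
          ∃ y', y = B₂.length + y' ∧ Al c x y' := by
        intro x hx y
        have := al_middle (a := diag B₂) (e := diag D₂) (y := y) hx
        rwa [top_diag, bot_diag] at this
      have d1 : ∀ x < (top c).length,
          Del (a ++ (diag B₁ ++ c ++ diag D₁) ++ e) ((top a).length + (B₁.length + x)) ↔
            Del c x := by
        intro x hx
        rw [del_middle (by rw [tw]; simp; omega)]
        have := del_middle (a := diag B₁) (e := diag D₁) hx
        rwa [top_diag] at this
      have a1 : ∀ x < (top c).length, ∀ y,
          Al (a ++ (diag B₁ ++ c ++ diag D₁) ++ e) ((top a).length + (B₁.length + x)) y ↔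
          ∃ y', y = (bot a).length + (B₁.length + y') ∧ Al c x y' := by
        intro x hx y
        rw [al_middle (by rw [tw]; simp; omega)]
        have := fun y => al_middle (a := diag B₁) (e := diag D₁) (y := y) hx
        simp only [top_diag, bot_diag] at this
        simp only [this]
        constructor
        · rintro ⟨_, rfl, y', rfl, h⟩
          exact ⟨y', rfl, h⟩
        · rintro ⟨y', rfl, h⟩
          exact ⟨_, rfl, y', rfl, h⟩
      have hij := hu.lt
      simp only at hij
      rcases h _ hu1 with h | ⟨⟨v1, v2⟩, hv, hx, hy⟩
      · simp only [d1 i (hij.trans hj'), d1 j hj'] at h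
        exact Or.inl (by simpa only [d2 i (hij.trans hj'), d2 j hj'] using h)
      · simp only [a1 i (hij.trans hj'), a1 j hj'] at hx hy
        obtain ⟨x, rfl, hx⟩ := hx
        obtain ⟨y, rfl, hy⟩ := hy
        rw [bot_append, bot_append] at hv
        have hv1 := hv.restrict (by rw [bw]; have := hy.lt; simp; omega)
        rw [bw] at hv1
        have hv2 := ((hv1.restrict hy.lt.2).embed B₂ D₂).embed (bot a) (bot e)
        rw [← bw, ← bot_append, ← bot_append] at hv2
        refine Or.inr ⟨_, hv2, ⟨_, rfl, ?_⟩, ⟨_, rfl, ?_⟩⟩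
        · exact (a2 i (hij.trans hj') _).2 ⟨x, rfl, hx⟩
        · exact (a2 j hj' _).2 ⟨y, rfl, hy⟩
    -- A node of the new context: taking out `top c` and inserting `bot c` turns it into a node of
    -- the second row, aligned along the diagonal.
    · have hj' := (not_congr (hu.mem_forest_iff hc)).1 hi'
      obtain ⟨i, rfl⟩ := exists_shift hi'
      obtain ⟨j, rfl⟩ := exists_shift hj'
      replace hu := hu.remove_shift hc
      have hv := (hu.insert_shift hc').embed (bot a) (bot e)
      rw [← bw, ← bot_append, ← bot_append] at hv
      have hd : ∀ x < (B₂ ++ D₂).length, Al (diag B₂ ++ c ++ diag D₂)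
          (shift B₂.length (top c).length x) (shift B₂.length (bot c).length x) := by
        intro x hx
        have := Al.shift (a := diag B₂) (w := c) (e := diag D₂) (x := x) (y := x)
          (by rw [diag, diag, ← List.map_append, ← diag, al_diag]; exact ⟨rfl, hx⟩)
        rwa [top_diag, bot_diag] at this
      refine Or.inr ⟨_, hv, ⟨_, rfl, hd i ?_⟩, ⟨_, rfl, hd j ?_⟩⟩
      · exact hu.lt.trans hu.lt_length
      · exact hu.lt_length
  -- A node outside the window survives the exchange of the new window for the old one; the old
  -- alignment treats it correctly, and its partner, if any, is carried back by the same exchange.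
  · have hj := (not_congr (hu.mem_forest_iff w2)).1 hi
    obtain ⟨i, rfl⟩ := exists_shift hi
    obtain ⟨j, rfl⟩ := exists_shift hj
    replace hu := (hu.remove_shift w2).insert_shift w1
    rw [← top_append, ← top_append] at hu
    rcases h _ hu with h | ⟨⟨v1, v2⟩, hv, hx, hy⟩
    · simp only [del_shift] at h
      exact Or.inl (by simpa only [del_shift] using h)
    · obtain ⟨x, rfl, hx'⟩ := hx.of_shift
      obtain ⟨y, rfl, hy'⟩ := hy.of_shift
      rw [bot_append, bot_append] at hv
      have hv := (hv.remove_shift w1').insert_shift w2'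
      rw [← bot_append, ← bot_append] at hv
      exact Or.inr ⟨_, hv, hx'.shift, hy'.shift⟩

/-! ### The image of an identically aligned context -/

/-- A node with its ends in the two halves of an identically aligned context is aligned to the
node with its ends at the corresponding positions. -/
theorem ForestCols.node_diag {a c e : List (Col (Paren α))} {B D : List (Paren α)}
    (h : ForestCols (a ++ (diag B ++ c ++ diag D) ++ e)) {i j : ℕ}
    (hi : i < B.length) (hj : j < D.length)
    (hu : IsNode (top a ++ (B ++ top c ++ D) ++ top e)
      ((top a).length + i, (top a).length + (B.length + (top c).length + j))) :
    IsNode (bot a ++ (B ++ bot c ++ D) ++ bot e)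
      ((bot a).length + i, (bot a).length + (B.length + (bot c).length + j)) := by
  have hu' : IsNode (top (a ++ (diag B ++ c ++ diag D) ++ e))
      ((top a).length + i, (top a).length + (B.length + (top c).length + j)) := by
    simpa using hu
  have e1 : i = shift (top (diag B)).length (top c).length i := by simp [shift, hi]
  have e2 : B.length + (top c).length + j =
      shift (top (diag B)).length (top c).length (B.length + j) := by
    rw [shift, if_neg (by simp)]; omega
  have hd : diag B ++ diag D = diag (B ++ D) := by simp [diag]
  rcases h _ hu' with h | ⟨⟨v1, v2⟩, hv, hx, hy⟩
  -- Deletion is impossible because the column of the opening end is a match.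
  · have h1 := (del_middle (by simp; omega)).1 h.1
    rw [e1, del_shift, hd] at h1
    exact absurd h1 not_del_diag
  · obtain ⟨x, rfl, hx₁⟩ := (al_middle (by simp; omega)).1 hx
    obtain ⟨y, rfl, hy₁⟩ := (al_middle (by simp; omega)).1 hy
    rw [e1] at hx₁
    rw [e2] at hy₁
    obtain ⟨x, rfl, hx₂⟩ := hx₁.of_shift
    obtain ⟨y, rfl, hy₂⟩ := hy₁.of_shift
    rw [hd, al_diag] at hx₂ hy₂
    obtain ⟨rfl, hx₃⟩ := hx₂
    obtain ⟨rfl, hy₃⟩ := hy₂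
    rw [bot_diag, shift, shift, if_pos hi, if_neg (by omega)] at hv
    simp only [bot_append, bot_diag] at hv
    convert hv using 3
    omega

/-- The hole lies strictly inside the tree, so the stack is non-empty after `L`. Its top label
belongs to the innermost node around the hole, and only balanced words separate that node's ends
from the hole. -/
theorem exists_innermost {L R : List (Paren α)} (h : IsTree (L ++ R)) (hL : L ≠ [])
    (hR : R ≠ []) : ∃ L' f g R' b, L = L' ++ Paren.op b :: f ∧ R = g ++ Paren.cl b :: R' ∧
      IsForest f ∧ IsForest g := by
  have hlen : 0 < height L := by
    have := h.height_take (n := L.length) (List.length_pos_iff.2 hL)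
      (by simpa using List.length_pos_iff.2 hR)
    rwa [List.take_left' rfl] at this
  have hr := h.isForest.run_eq []
  rw [run_append] at hr
  cases hs : run [] L with
  | none => simp [hs] at hr
  | some st =>
    simp [hs] at hr
    have h1 := opens_of_run L st hs
    have h2 := closes_of_run R st hr
    cases st with
    | nil =>
      have : IsForest L := h1
      have := this.height_eq
      omega
    | cons b st =>
      obtain ⟨L', f, hL, hf, -⟩ := h1
      obtain ⟨g, R', hg, hR, -⟩ := h2
      exact ⟨L', f, g, R', b, hL, hR, hf, hg⟩

/-- The part of the second string enclosed by an identically aligned context is a forest. -/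
theorem ForestCols.isForest_bot {a c e : List (Col (Paren α))} {L R : List (Paren α)}
    (h : ForestCols (a ++ (diag L ++ c ++ diag R) ++ e)) (hc : IsForest (top c))
    (ht : IsTree (L ++ R)) (hL : L ≠ []) (hR : R ≠ []) : IsForest (bot c) := by
  -- The innermost node around the hole is mapped to a node whose content is `f`, `bot c`, `g`;
  -- cancelling the balanced words `f` and `g` leaves `bot c`.
  obtain ⟨L', f, g, R', b, hL, hR, hf, hg⟩ := exists_innermost ht hL hR
  have hT : IsTree (Paren.op b :: f ++ top c ++ g ++ [Paren.cl b]) :=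
    ⟨b, f ++ top c ++ g, (hf.append hc).append hg, by simp⟩
  have hu : IsNode (top a ++ (L ++ top c ++ R) ++ top e)
      ((top a).length + L'.length, (top a).length + (L.length + (top c).length + g.length)) := by
    have := isNode_of_tree (top a ++ L') (R' ++ top e) hT
      (i := (top a).length + L'.length)
      (j := (top a).length + (L.length + (top c).length + g.length))
      (by simp) (by rw [hL]; simp; omega)
    rw [hL, hR]
    rw [hL] at this
    simpa using this
  have hv := h.node_diag (by rw [hL]; simp) (by rw [hR]; simp) hu
  obtain ⟨-, -, b', f', hf', hv⟩ := hv
  have e1 : bot a ++ (L ++ bot c ++ R) ++ bot e =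
      (bot a ++ L') ++ (Paren.op b :: f ++ bot c ++ g ++ [Paren.cl b]) ++ (R' ++ bot e) := by
    rw [hL, hR]; simp
  have e2 : (bot a).length + (L.length + (bot c).length + g.length) + 1 =
      (bot a ++ L').length + (Paren.op b :: f ++ bot c ++ g ++ [Paren.cl b]).length := by
    rw [hL]; simp; omega
  have e3 : (bot a).length + L'.length = (bot a ++ L').length + 0 := by simp
  simp only at hv
  rw [e1, e2, e3, frag_append le_rfl] at hv
  simp only [frag, List.take_length, List.drop_zero] at hv
  have hv' : Paren.op b :: (f ++ bot c ++ g) ++ [Paren.cl b] =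
      Paren.op b' :: f' ++ [Paren.cl b'] := by simpa using hv
  obtain ⟨hv', -⟩ := List.append_inj' hv' rfl
  simp only [List.cons.injEq] at hv'
  rw [← hv'.2] at hf'
  exact (hf'.of_append_right hg).of_append_left hf

/-! ### Cutting an alignment at positions of the first string -/

/-- The shortest list of initial columns covering the first `n` positions of the first row. -/
def pre : ℕ → List (Col β) → List (Col β)
  | 0, _ => []
  | _ + 1, [] => []
  | n + 1, .ins b :: s => .ins b :: pre (n + 1) s
  | n + 1, .del a :: s => .del a :: pre n s
  | n + 1, .sub a b :: s => .sub a b :: pre n s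

/-- The columns that are not in `pre n s`. -/
def post : ℕ → List (Col β) → List (Col β)
  | 0, s => s
  | _ + 1, [] => []
  | n + 1, .ins _ :: s => post (n + 1) s
  | n + 1, .del _ :: s => post n s
  | n + 1, .sub _ _ :: s => post n s

theorem pre_append_post (n : ℕ) (s : List (Col β)) : pre n s ++ post n s = s := by
  induction n, s using pre.induct <;> simp_all [pre, post]

theorem top_pre (n : ℕ) (s : List (Col β)) : top (pre n s) = (top s).take n := by
  induction n, s using pre.induct <;> simp_all [pre]

theorem top_post (n : ℕ) (s : List (Col β)) : top (post n s) = (top s).drop n := by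
  induction n, s using pre.induct <;> simp_all [post]

theorem pre_add (n m : ℕ) (s : List (Col β)) :
    pre (n + m) s = pre n s ++ pre m (post n s) := by
  induction n, s using pre.induct with
  | case1 s => simp [pre, post]
  | case2 n => cases m <;> simp [pre, post]
  | case3 n b s ih =>
    rw [show n + 1 + m = n + m + 1 by ring] at *
    simp [pre, post, ih]
  | case4 n b s ih =>
    rw [show n + 1 + m = n + m + 1 by ring] at *
    simp [pre, post, ih]
  | case5 n a b s ih =>
    rw [show n + 1 + m = n + m + 1 by ring] at *
    simp [pre, post, ih]

/-! ### Counting edits -/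

/-- The number of deletions. -/
def ndel (s : List (Col β)) : ℕ := (s.map fun | .del _ => 1 | _ => 0).sum

/-- The number of insertions. -/
def nins (s : List (Col β)) : ℕ := (s.map fun | .ins _ => 1 | _ => 0).sum

open Classical in
/-- The number of columns other than matches. -/
noncomputable def nedit (s : List (Col β)) : ℕ :=
  (s.map fun | .sub a b => if a = b then 0 else 1 | _ => 1).sum

open Classical in
/-- The number of columns other than matches, where all but the deletions count twice. -/
noncomputable def weight (s : List (Col β)) : ℕ :=
  (s.map fun | .del _ => 1 | .ins _ => 2 | .sub a b => if a = b then 0 else 2).sum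

theorem ndel_append (s t : List (Col β)) : ndel (s ++ t) = ndel s + ndel t := by
  simp [ndel]

theorem nins_append (s t : List (Col β)) : nins (s ++ t) = nins s + nins t := by
  simp [nins]

theorem weight_append (s t : List (Col β)) : weight (s ++ t) = weight s + weight t := by
  simp [weight]

theorem length_bot (s : List (Col β)) :
    (bot s).length + ndel s = (top s).length + nins s := by
  induction s with
  | nil => simp [ndel, nins]
  | cons c s ih => cases c <;> simp [ndel, nins] at * <;> omega

/-- Deletions are half price in `weight` since they occur in pairs within a layer, whereas the ends
of an inserted node may fall into different layers. The saved `ndel s` offsets the drift of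
positions caused by deletions in `exists_layer`. -/
theorem weight_add_ndel (s : List (Col β)) : weight s + ndel s = 2 * nedit s := by
  induction s with
  | nil => simp [weight, ndel, nedit]
  | cons c s ih =>
    cases c with
    | del a => simp [weight, ndel, nedit] at *; omega
    | ins a => simp [weight, ndel, nedit] at *; omega
    | sub a b => by_cases h : a = b <;> simp [weight, ndel, nedit, h] at * <;> omega

theorem nins_add_ndel_le (s : List (Col β)) : nins s + ndel s ≤ nedit s := by
  induction s with
  | nil => simp [nins, ndel, nedit]
  | cons c s ih => cases c <;> simp [nins, ndel, nedit] at * <;> omega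

theorem nedit_le_colCost (w : Option β → Option β → ℝ≥0∞) (s : List (Col β))
    (h : ∀ c ∈ s, c.fst ≠ c.snd → 1 ≤ w c.fst c.snd) : (nedit s : ℝ≥0∞) ≤ colCost w s := by
  induction s with
  | nil => simp [nedit]
  | cons c s ih =>
    have ih := ih fun d hd => h d (List.mem_cons_of_mem _ hd)
    have hc := h c List.mem_cons_self
    have e : colCost w (c :: s) = w c.fst c.snd + colCost w s := by simp [colCost]
    rw [e]
    have e1 : nedit (c :: s) = nedit [c] + nedit s := by
      simp [nedit]
    rw [e1, Nat.cast_add]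
    refine add_le_add ?_ ih
    cases c with
    | del a => simpa [nedit] using hc (by simp [Col.fst, Col.snd])
    | ins a => simpa [nedit] using hc (by simp [Col.fst, Col.snd])
    | sub a b =>
      by_cases hab : a = b
      · simp [nedit, hab]
      · simpa [nedit, hab] using hc (by simpa [Col.fst, Col.snd] using hab)

theorem eq_diag_of_weight {s : List (Col β)} (h : weight s = 0) : s = diag (top s) := by
  induction s with
  | nil => rfl
  | cons c s ih =>
    cases c with
    | del a => simp [weight] at h
    | ins a => simp [weight] at h
    | sub a b =>
      by_cases hab : a = b
      · subst hab
        have := ih (by simpa [weight] using h)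
        rw [top_sub, diag, List.map_cons, ← diag, ← this]
      · simp [weight, hab] at h

/-! ### Paired deletions and the cost of edits -/

theorem Del.weight_pos {s : List (Col β)} {x : ℕ} (h : Del s x) : 1 ≤ weight s := by
  obtain ⟨s₁, p, s₂, rfl, -⟩ := h
  rw [weight_append]
  simp [weight]
  omega

theorem Del.two_le_weight {s : List (Col β)} {x y : ℕ} (hx : Del s x) (hy : Del s y)
    (hxy : x < y) : 2 ≤ weight s := by
  obtain ⟨s₁, p, s₂, rfl, rfl⟩ := hx
  have e : s₁ ++ Col.del p :: s₂ = (s₁ ++ [Col.del p]) ++ s₂ := by simp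
  rw [e] at hy ⊢
  rcases del_append.1 hy with h | ⟨x', h, -⟩
  · have := h.lt
    simp at this
    omega
  · have := h.weight_pos
    have h2 : weight (s₁ ++ [Col.del p]) = weight s₁ + 1 := by
      rw [weight_append]; simp [weight]
    rw [weight_append, h2]
    omega

theorem exists_del_of_weight {s : List (Col β)} (h1 : weight s < 2) (h2 : weight s ≠ 0) :
    ∃ x, Del s x := by
  induction s with
  | nil => simp [weight] at h2
  | cons c s ih =>
    cases c with
    | del a => exact ⟨0, [], a, s, rfl, rfl⟩
    | ins a => simp [weight] at h1; omega
    | sub a b =>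
      by_cases hab : a = b
      · obtain ⟨x, hx⟩ := ih (by simpa [weight, hab] using h1) (by simpa [weight, hab] using h2)
        exact ⟨_, del_cons.2 (Or.inr ⟨x, hx, rfl⟩)⟩
      · simp [weight, hab] at h1; omega

theorem Del.not_al {s : List (Col β)} : ∀ {x y : ℕ}, Del s x → ¬ Al s x y := by
  induction s with
  | nil => intro x y h; exact absurd h not_del_nil
  | cons c s ih =>
    intro x y h h'
    rw [del_cons] at h
    rw [al_cons] at h'
    rcases h with ⟨rfl, p, rfl⟩ | ⟨x₁, h, rfl⟩ <;>
      rcases h' with ⟨h1, -, p', q, h2⟩ | ⟨x₂, y₂, h', h1, rfl⟩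
    · cases h2
    · simp at h1
    · subst h2
      simp at h1
    · obtain rfl : x₁ = x₂ := by omega
      exact ih h h'

/-- A context whose columns have weight less than two is aligned identically: deletions come in
pairs. -/
theorem ForestCols.layer_diag {a c e sL sR : List (Col (Paren α))}
    (h : ForestCols (a ++ (sL ++ c ++ sR) ++ e)) (hc : IsForest (top c))
    (ht : IsForest (top sL ++ top sR)) (hw : weight sL + weight sR < 2) :
    sL = diag (top sL) ∧ sR = diag (top sR) := by
  rw [← weight_append] at hw
  by_cases h0 : weight (sL ++ sR) = 0
  · rw [weight_append] at h0
    exact ⟨eq_diag_of_weight (by omega), eq_diag_of_weight (by omega)⟩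
  exfalso
  -- Every other edit weighs two, so there is a deletion. The layer is balanced, so the node at `x`
  -- has both ends in it; they are both deleted, which costs two, or both aligned, which contradicts
  -- the deletion.
  obtain ⟨x, hx⟩ := exists_del_of_weight hw h0
  rw [← top_append] at ht
  obtain ⟨⟨i, j⟩, hu, hux⟩ := ht.exists_node x hx.lt
  have hu' := hu
  rw [top_append] at hu'
  have hn := (hu'.insert_shift hc).embed (top a) (top e)
  rw [← top_append, ← top_append, ← top_append, ← top_append] at hn
  have hlt : ∀ i < (top (sL ++ sR)).length,
      shift (top sL).length (top c).length i < (top (sL ++ c ++ sR)).length := by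
    intro i hi
    simp at hi ⊢
    unfold shift
    split_ifs <;> omega
  have hj : j < (top (sL ++ sR)).length := hu.lt_length
  have hi : i < (top (sL ++ sR)).length := lt_trans hu.lt hj
  have hD : ∀ i < (top (sL ++ sR)).length, Del (a ++ (sL ++ c ++ sR) ++ e)
      ((top a).length + shift (top sL).length (top c).length i) ↔ Del (sL ++ sR) i := by
    intro i hi
    rw [del_middle (hlt i hi), del_shift]
  rcases h _ hn with ⟨h1, h2⟩ | ⟨v, -, h1, h2⟩
  · have := ((hD i hi).1 h1).two_le_weight ((hD j hj).1 h2) hu.lt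
    omega
  · have := (hD x hx.lt).2 hx
    rcases hux with rfl | rfl
    · exact this.not_al h1
    · exact this.not_al h2

theorem Al.unique {s : List (Col β)} : ∀ {x y y' : ℕ}, Al s x y → Al s x y' → y = y' := by
  induction s with
  | nil => intro x y y' h; exact absurd h not_al_nil
  | cons c s ih =>
    intro x y y' h h'
    rw [al_cons] at h h'
    rcases h with ⟨rfl, rfl, p, q, rfl⟩ | ⟨x₁, y₁, h, rfl, rfl⟩ <;>
      rcases h' with ⟨h1, rfl, p', q', h2⟩ | ⟨x₂, y₂, h', h1, rfl⟩
    · rfl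
    · simp at h1
    · subst h2
      simp at h1
    · obtain rfl : x₁ = x₂ := by omega
      rw [ih h h']

/-- Weights see only labels, so aligning an opening to a closing parenthesis of the same label would
be free. Forest alignments exclude this, because node ends are aligned to node ends of the same
kind. -/
theorem ForestCols.label_ne {s : List (Col (Paren α))} (h : ForestCols s)
    (ht : IsForest (top s)) {p q : Paren α} (hs : Col.sub p q ∈ s) (hpq : p ≠ q) :
    p.label ≠ q.label := by
  obtain ⟨s₁, s₂, rfl⟩ := List.append_of_mem hs
  have hal : Al (s₁ ++ Col.sub p q :: s₂) (top s₁).length (bot s₁).length :=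
    ⟨s₁, p, q, s₂, rfl, rfl, rfl⟩
  have hp : (top (s₁ ++ Col.sub p q :: s₂))[(top s₁).length]? = some p := by simp
  have hq : (bot (s₁ ++ Col.sub p q :: s₂))[(bot s₁).length]? = some q := by simp
  obtain ⟨u, hu, hux⟩ := ht.exists_node _ hal.lt.1
  rcases h u hu with ⟨h1, h2⟩ | ⟨v, hv, h1, h2⟩
  · rcases hux with hux | hux
    · rw [hux] at h1
      exact absurd hal h1.not_al
    · rw [hux] at h2
      exact absurd hal h2.not_al
  · rcases hux with hux | hux
    · rw [hux] at h1
      obtain ⟨a, ha⟩ := hu.getElem?_fst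
      obtain ⟨b, hb⟩ := hv.getElem?_fst
      rw [hux, hp] at ha
      rw [← hal.unique h1, hq] at hb
      cases ha
      cases hb
      intro hab
      simp only [Paren.label] at hab
      exact hpq (by rw [hab])
    · rw [hux] at h2
      obtain ⟨a, ha⟩ := hu.getElem?_snd
      obtain ⟨b, hb⟩ := hv.getElem?_snd
      rw [hux, hp] at ha
      rw [← hal.unique h2, hq] at hb
      cases ha
      cases hb
      intro hab
      simp only [Paren.label] at hab
      exact hpq (by rw [hab])

theorem ForestCols.nedit_le {w : Option α → Option α → ℝ≥0∞} (hw : IsNormalized w)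
    {s : List (Col (Paren α))} (h : ForestCols s) (ht : IsForest (top s)) :
    (nedit s : ℝ≥0∞) ≤ colCost (parenWeight w) s := by
  refine nedit_le_colCost _ _ fun c hc hne => hw _ _ ?_
  cases c with
  | del a => simp [Col.fst, Col.snd]
  | ins a => simp [Col.fst, Col.snd]
  | sub p q =>
    have := h.label_ne ht hc (by simpa [Col.fst, Col.snd] using hne)
    simpa [Col.fst, Col.snd] using this

/-! ### Counting layers -/

theorem sub_le_card_filter {U : ℕ → Prop} [DecidablePred U] {a b e : ℕ} (hb : b ≤ e)
    (h : ∀ j, a ≤ j → j < b → ¬ U j) : b - a ≤ ((Finset.range e).filter fun j => ¬ U j).card := by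
  rw [← Nat.card_Ico]
  refine Finset.card_le_card fun j hj => ?_
  rw [Finset.mem_Ico] at hj
  simp only [Finset.mem_filter, Finset.mem_range]
  exact ⟨by omega, h j hj.1 hj.2⟩

/-- Among `e` nested layers, of which `U` are aligned identically, some layer in `U` has its two
halves aligned to fragments of the two periodic parts of the second string. -/
theorem exists_layer {k e : ℕ} (hk : 1 ≤ k) (he : 6 * k ≤ e) {l r o q o' q' d i : ℤ}
    {yl yr : ℕ → ℤ} {U : ℕ → Prop} [DecidablePred U] (hl : 1 ≤ l) (hr : 1 ≤ r)
    (ho : |o - o'| ≤ 2 * k) (hq : |q - q'| ≤ 2 * k)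
    (hlen : e * (l + r) ≤ q - o) (hlen' : e * (l + r) ≤ q' - o')
    (hd : 0 ≤ d) (hi : 0 ≤ i) (hid : i + d ≤ 2 * k)
    (hcount : 2 * (((Finset.range e).filter fun j => ¬ U j).card : ℤ) + d ≤ 4 * k)
    (hyl : ∀ j < e, o + j * l - d ≤ yl j) (hyl' : ∀ j < e, yl j ≤ o + j * l + i)
    (hyr : ∀ j < e, q - j * r - d ≤ yr j)
    (hll : ∀ j₀ j₁, j₀ ≤ j₁ → j₁ < e → yl j₁ - yl j₀ ≤ (j₁ - j₀) * l + i)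
    (hrr : ∀ j₀ j₁, j₀ ≤ j₁ → j₁ < e → yr j₀ - yr j₁ ≤ (j₁ - j₀) * r + i)
    (hout : ∀ j < e, U j → yl j < o' → o' < yr j → q' < yr j)
    (hin : ∀ j < e, U j → o' ≤ yl j → yl j < q' → yr j ≤ q')
    (hinner : ∀ j < e, U j → o' + (e - 1) * l < yl j → yl j < q' - (e - 1) * r →
      yr j < q' - (e - 1) * r) :
    ∃ j < e, U j ∧ o' ≤ yl j ∧ yl j + l ≤ o' + e * l ∧ yr j ≤ q' ∧ q' - e * r ≤ yr j - r := by
  -- In the application `yl j` and `yr j` delimit the image of layer `j`, the two powers occupy `[o,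
  -- q)` and `[o', q')`, and `d`, `i` count deletions and insertions.
  by_contra! hno
  rw [abs_le] at ho hq
  have heZ : (6 * k : ℤ) ≤ e := by exact_mod_cast he
  have hkZ : (1 : ℤ) ≤ k := by exact_mod_cast hk
  have hmul : ∀ (x y : ℤ), 0 ≤ x → 1 ≤ y → x ≤ x * y := fun x y hx hy => by nlinarith
  have hel := hmul e l (by omega) hl
  have her := hmul e r (by omega) hr
  have out : ∀ j < e, U j → yl j < o' → q' < yr j := by
    intro j hj hU h
    refine hout j hj hU h ?_
    have h1 := hyr j hj
    have h2 : (j : ℤ) * r ≤ e * r := by gcongr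
    nlinarith
  -- A layer in `U` that starts inside the second power and fails the conclusion has passed the
  -- start or the end of the innermost copy on one side.
  have inner : ∀ j < e, U j → o' ≤ yl j →
      o' + (e - 1) * l < yl j ∨ yr j < q' - (e - 1) * r := by
    intro j hj hU h
    by_contra! h'
    have h1 := hyl' j hj
    have h2 : (j : ℤ) * l ≤ e * l := by gcongr
    have h3 := hin j hj hU h (by nlinarith)
    have h4 := hno j hj hU h (by linarith) h3
    linarith
  by_cases hex : ∃ j, j < e ∧ U j ∧ o' ≤ yl j
  · classical
    have hj₁ := Nat.find_spec hex
    have hmin : ∀ j < Nat.find hex, U j → yl j < o' := by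
      intro j hj hU
      by_contra! h
      exact Nat.find_min hex hj ⟨hj.trans hj₁.1, hU, h⟩
    generalize Nat.find hex = j₁ at hj₁ hmin
    obtain ⟨hj₁, hU₁, hj₁o⟩ := hj₁
    by_cases hex' : ∃ j, j < j₁ ∧ U j
    · obtain ⟨j₀, hj₀, hmax⟩ := Finset.exists_max_image ((Finset.range j₁).filter U) id
        (by obtain ⟨j, hj⟩ := hex'; exact ⟨j, by simpa using hj⟩)
      simp only [Finset.mem_filter, Finset.mem_range, id] at hj₀ hmax
      -- No layer strictly between `j₀` and `j₁` is in `U`, so there are at most `2k` of them. Yet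
      -- one end of the image moves from outside the power past `e - 1` periods, while at most `2k +
      -- 1` periods and `2k` insertions are available.
      have hc := sub_le_card_filter (U := U) (a := j₀ + 1) (b := j₁) hj₁.le
        (fun j h1 h2 h3 => by have := hmax j ⟨h2, h3⟩; omega)
      have hc' : (j₁ : ℤ) - j₀ - 1 ≤ 2 * k := by omega
      have hlt : (j₀ : ℤ) < j₁ := by exact_mod_cast hj₀.1
      have h0 := hmin j₀ hj₀.1 hj₀.2
      have h0' := out j₀ (hj₀.1.trans hj₁) hj₀.2 h0
      rcases inner j₁ hj₁ hU₁ hj₁o with h | h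
      · have := hll j₀ j₁ hj₀.1.le hj₁
        have h2 := hmul (e - 1 - (j₁ - j₀)) l (by linarith) hl
        nlinarith
      · have := hrr j₀ j₁ hj₀.1.le hj₁
        have h2 := hmul (e - 1 - (j₁ - j₀)) r (by linarith) hr
        nlinarith
    · push Not at hex'
      have hc := sub_le_card_filter (U := U) (a := 0) (b := j₁) hj₁.le
        (fun j _ h2 => hex' j h2)
      have hc' : 2 * (j₁ : ℤ) + d ≤ 4 * k := by omega
      -- If the left end is too deep, the image starts after the innermost copy does, so by
      -- non-crossing its right end is too deep as well.
      have h : yr j₁ < q' - (e - 1) * r := by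
        rcases inner j₁ hj₁ hU₁ hj₁o with h | h
        · refine hinner j₁ hj₁ hU₁ h ?_
          have h1 := hyl' j₁ hj₁
          have h2 : (j₁ : ℤ) * l ≤ 2 * k * l := by gcongr; linarith
          have h3 : (6 * k : ℤ) * l ≤ e * l := by gcongr
          have h4 := hmul (4 * k) l (by linarith) hl
          nlinarith
        · exact h
      -- This gives `(e - 1 - j₁) * r < 2k + d`. But `2 * j₁ + d ≤ 4k` and `d ≤ 2k` imply `j₁ + d ≤
      -- 3k ≤ 4k - 1`, contradicting `e ≥ 6k`.
      have h1 := hyr j₁ hj₁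
      have h2 : (j₁ : ℤ) + 1 ≤ e := by exact_mod_cast hj₁
      have h3 := hmul (e - 1 - j₁) r (by linarith) hr
      nlinarith
  · push Not at hex
    by_cases hex' : ∃ j, j < e ∧ U j
    · obtain ⟨j₀, hj₀, hmax⟩ := Finset.exists_max_image ((Finset.range e).filter U) id
        (by obtain ⟨j, hj⟩ := hex'; exact ⟨j, by simpa using hj⟩)
      simp only [Finset.mem_filter, Finset.mem_range, id] at hj₀ hmax
      -- All layers of `U` start to the left of the second power, although the last of them is too
      -- deep in the first power for a drift of `2k + d` to achieve this.
      have hc := sub_le_card_filter (U := U) (a := j₀ + 1) (b := e) le_rfl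
        (fun j h1 h2 h3 => by have := hmax j ⟨h2, h3⟩; omega)
      have hc' : 2 * ((e : ℤ) - j₀ - 1) + d ≤ 4 * k := by omega
      have h0 := hex j₀ hj₀.1 hj₀.2
      have h1 := hyl j₀ hj₀.1
      have h2 := hmul j₀ l (by omega) hl
      linarith
    · push Not at hex'
      have hc := sub_le_card_filter (U := U) (a := 0) (b := e) le_rfl
        (fun j _ h2 => hex' j h2)
      omega

/-! ### Powers of strings -/

/-- The concatenation of `n` copies of `L`. -/
def rep (n : ℕ) (L : List β) : List β := (List.replicate n L).flatten

@[simp] theorem rep_zero (L : List β) : rep 0 L = [] := rfl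

theorem rep_succ (n : ℕ) (L : List β) : rep (n + 1) L = L ++ rep n L := by
  simp [rep, List.replicate_succ]

theorem rep_add (m n : ℕ) (L : List β) : rep (m + n) L = rep m L ++ rep n L := by
  rw [rep, rep, rep, List.replicate_add, List.flatten_append]

theorem rep_one (L : List β) : rep 1 L = L := by simp [rep]

theorem rep_succ' (n : ℕ) (L : List β) : rep (n + 1) L = rep n L ++ L := by
  rw [rep_add, rep_one]

@[simp] theorem length_rep (n : ℕ) (L : List β) : (rep n L).length = n * L.length := by
  simp [rep]

/-- An occurrence of `L` in a power of `L` can be replaced by any power of `L`. -/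
theorem rep_replace {e : ℕ} {L p s : List β} (h : p ++ L ++ s = rep (e + 1) L) (m : ℕ) :
    p ++ rep m L ++ s = rep (e + m) L := by
  -- Powers of `L` commute with `L`; comparing prefixes of equal length shows that `p` commutes with
  -- `L` too, whatever its length.
  have hcomm : p ++ L = L ++ p := by
    have : (p ++ L) ++ (s ++ L) = (L ++ p) ++ (L ++ s) := by
      calc (p ++ L) ++ (s ++ L) = rep (e + 1) L ++ L := by rw [← h]; simp
        _ = L ++ rep (e + 1) L := by rw [← rep_succ, ← rep_succ']
        _ = (L ++ p) ++ (L ++ s) := by rw [← h]; simp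
    exact (List.append_inj this (by simp; omega)).1
  have hps : p ++ s = rep e L := by
    rw [hcomm, rep_succ, List.append_assoc] at h
    exact List.append_cancel_left h
  have hcomm' : ∀ m, p ++ rep m L = rep m L ++ p := by
    intro m
    induction m with
    | zero => simp
    | succ m ih => rw [rep_succ, ← List.append_assoc, hcomm, List.append_assoc, ih,
        List.append_assoc]
  rw [hcomm', List.append_assoc, hps, ← rep_add, add_comm]

theorem exists_rep_replace {e : ℕ} {L P S X Z : List β}
    (h : P ++ L ++ S = X ++ rep (e + 1) L ++ Z) (h1 : X.length ≤ P.length)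
    (h2 : P.length + L.length ≤ X.length + (e + 1) * L.length) :
    ∃ p s, P = X ++ p ∧ S = s ++ Z ∧ p.length + s.length = e * L.length ∧
      ∀ m, p ++ rep m L ++ s = rep (e + m) L := by
  obtain ⟨p, rfl⟩ : X <+: P := by
    refine List.prefix_of_prefix_length_le (l₃ := P ++ L ++ S) ?_ ?_ h1
    · rw [h, List.append_assoc]; exact List.prefix_append _ _
    · rw [List.append_assoc]; exact List.prefix_append _ _
  obtain ⟨s, rfl⟩ : Z <:+ S := by
    refine List.suffix_of_suffix_length_le (l₃ := X ++ p ++ L ++ S) ?_ ?_ ?_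
    · rw [h]; exact List.suffix_append _ _
    · exact List.suffix_append _ _
    · have := congrArg List.length h
      simp at this h2
      omega
  have h3 : p ++ L ++ s = rep (e + 1) L := by
    have : X ++ (p ++ L ++ s ++ Z) = X ++ (rep (e + 1) L ++ Z) := by simpa using h
    exact List.append_cancel_right (List.append_cancel_left this)
  refine ⟨p, s, rfl, rfl, ?_, rep_replace h3⟩
  have := congrArg List.length h3
  simp [Nat.add_mul] at this
  omega

theorem isForest_rep {L R M : List (Paren α)} (h : IsForest (L ++ R)) (hM : IsForest M)
    (n : ℕ) : IsForest (rep n L ++ M ++ rep n R) := by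
  induction n with
  | zero => simpa using hM
  | succ n ih =>
    rw [rep_succ, rep_succ']
    simpa using h.insert ih

theorem isTree_rep {L R M : List (Paren α)} (h : IsTree (L ++ R)) (hL : L ≠ []) (hR : R ≠ [])
    (hM : IsForest M) (n : ℕ) : IsTree (rep (n + 1) L ++ M ++ rep (n + 1) R) := by
  rw [rep_succ, rep_succ']
  have := IsTree.replace (c := []) (by simpa using h) hL hR IsForest.nil
    (isForest_rep h.isForest hM n)
  simpa using this

/-! ### Prefixes of alignments -/

theorem length_top_pre {s : List (Col β)} {n : ℕ} (h : n ≤ (top s).length) :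
    (top (pre n s)).length = n := by
  rw [top_pre, List.length_take, min_eq_left h]

theorem pre_eq_append {s : List (Col β)} {n m : ℕ} (h : n ≤ m) :
    pre m s = pre n s ++ pre (m - n) (post n s) := by
  rw [← pre_add, Nat.add_sub_cancel' h]

/-- Positions drift backwards by at most the number of deletions and, in the companion bound below,
forwards by at most the number of insertions. -/
theorem le_length_bot_pre {s : List (Col β)} {n : ℕ} (h : n ≤ (top s).length) :
    n ≤ (bot (pre n s)).length + ndel s := by
  have h1 := length_bot (pre n s)
  have h2 : ndel s = ndel (pre n s) + ndel (post n s) := by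
    rw [← ndel_append, pre_append_post]
  rw [length_top_pre h] at h1
  omega

theorem length_bot_pre_le {s : List (Col β)} {n m : ℕ} (hnm : n ≤ m)
    (h : m ≤ (top s).length) :
    (bot (pre m s)).length ≤ (bot (pre n s)).length + (m - n) + nins s := by
  have h1 := length_bot (pre (m - n) (post n s))
  have h2 : nins s = nins (pre n s) + (nins (pre (m - n) (post n s)) +
      nins (post (m - n) (post n s))) := by
    rw [← nins_append, ← nins_append, pre_append_post, pre_append_post]
  rw [length_top_pre (by rw [top_post, List.length_drop]; omega)] at h1
  rw [pre_eq_append hnm, bot_append, List.length_append]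
  omega

theorem weight_pre_mono {s : List (Col β)} {n m : ℕ} (hnm : n ≤ m) :
    weight (pre n s) ≤ weight (pre m s) := by
  rw [pre_eq_append hnm, weight_append]
  omega

theorem weight_pre_le (s : List (Col β)) (n : ℕ) : weight (pre n s) ≤ weight s := by
  conv_rhs => rw [← pre_append_post n s, weight_append]
  omega

/-- The number of disjoint pairs of windows with at least two units of weight. -/
theorem two_mul_card_le_weight (s : List (Col β)) {e l r o q : ℕ}
    (h : o + e * l + e * r ≤ q) :
    2 * ((Finset.range e).filter fun j =>
      ¬ (weight (pre (o + j * l + l) s) + weight (pre (q - j * r) s) <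
        weight (pre (o + j * l) s) + weight (pre (q - j * r - r) s) + 2)).card ≤ weight s := by
  set f : ℕ → ℤ := fun j => weight (pre (o + j * l) s)
  set g : ℕ → ℤ := fun j => weight (pre (q - j * r) s)
  have hf : ∀ j, f j ≤ f (j + 1) := fun j => by
    simp only [f]
    exact_mod_cast weight_pre_mono (by nlinarith)
  have hg : ∀ j, g (j + 1) ≤ g j := fun j => by
    simp only [g]
    exact_mod_cast weight_pre_mono (Nat.sub_le_sub_left (by nlinarith) _)
  -- The left windows advance and the right windows retreat, so the weights of the layers telescope;
  -- `f e ≤ g e` below says that the two groups do not overlap.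
  have h1 : (∑ j ∈ Finset.range e, ((f (j + 1) - f j) + (g j - g (j + 1)))) =
      (f e - f 0) + (g 0 - g e) := by
    rw [Finset.sum_add_distrib, Finset.sum_range_sub, Finset.sum_range_sub']
  have h2 : ((((Finset.range e).filter fun j =>
      ¬ (weight (pre (o + j * l + l) s) + weight (pre (q - j * r) s) <
        weight (pre (o + j * l) s) + weight (pre (q - j * r - r) s) + 2)).card * 2 : ℕ) : ℤ) ≤
      ∑ j ∈ Finset.range e, ((f (j + 1) - f j) + (g j - g (j + 1))) := by
    rw [Finset.card_filter, Finset.sum_mul, Nat.cast_sum]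
    refine Finset.sum_le_sum fun j _ => ?_
    have e1 : o + (j + 1) * l = o + j * l + l := by ring
    have e2 : q - (j + 1) * r = q - j * r - r := by rw [add_mul, one_mul, Nat.sub_sub]
    have := hf j
    have := hg j
    simp only [f, g, e1, e2] at *
    split_ifs with hj <;> push_cast <;> omega
  have h3 : f e ≤ g e := by
    simp only [f, g]
    exact_mod_cast weight_pre_mono (by omega)
  have h4 : g 0 ≤ weight s := by
    simp only [g]
    exact_mod_cast weight_pre_le s _
  have h5 : 0 ≤ f 0 := by positivity
  rw [h1] at h2
  push_cast at h2
  have : (2 : ℤ) * (((Finset.range e).filter fun j =>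
      ¬ (weight (pre (o + j * l + l) s) + weight (pre (q - j * r) s) <
        weight (pre (o + j * l) s) + weight (pre (q - j * r - r) s) + 2)).card : ℤ) ≤
      weight s := by linarith
  exact_mod_cast this

/-! ### Identically aligned layers of vertical powers -/

/-- A layer of small weight is aligned identically to a node of the second forest. -/
theorem ForestCols.exists_diag {s : List (Col (Paren α))} (h : ForestCols s)
    {A L C R E : List (Paren α)} (hs : top s = A ++ (L ++ C ++ R) ++ E) (hC : IsForest C)
    (ht : IsTree (L ++ R)) (hL : L ≠ []) (hR : R ≠ []) {x₁ x₂ x₃ x₄ : ℕ} (h₁ : x₁ = A.length)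
    (h₂ : x₂ = x₁ + L.length) (h₃ : x₃ = x₂ + C.length) (h₄ : x₄ = x₃ + R.length)
    (hw : weight (pre x₂ s) + weight (pre x₄ s) < weight (pre x₁ s) + weight (pre x₃ s) + 2) :
    ∃ a c e, s = a ++ (diag L ++ c ++ diag R) ++ e ∧ top a = A ∧ top c = C ∧ top e = E ∧
      a = pre x₁ s ∧ a ++ (diag L ++ c ++ diag R) = pre x₄ s ∧
      IsNode (bot s) ((bot (pre x₁ s)).length, (bot (pre x₄ s)).length - 1) := by
  have p2 : pre x₂ s = pre x₁ s ++ pre L.length (post x₁ s) := by rw [h₂, pre_add]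
  have p3 : pre x₃ s = pre x₂ s ++ pre C.length (post x₂ s) := by rw [h₃, pre_add]
  have p4 : pre x₄ s = pre x₃ s ++ pre R.length (post x₃ s) := by rw [h₄, pre_add]
  have t1 : top (pre x₁ s) = A := by rw [top_pre, hs, h₁]; simp
  have t2 : top (pre L.length (post x₁ s)) = L := by rw [top_pre, top_post, hs, h₁]; simp
  have t3 : top (pre C.length (post x₂ s)) = C := by
    rw [top_pre, top_post, hs, h₂, h₁]
    have : A ++ (L ++ C ++ R) ++ E = (A ++ L) ++ (C ++ (R ++ E)) := by simp
    rw [this, List.drop_left' (by simp), List.take_left' rfl]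
  have t4 : top (pre R.length (post x₃ s)) = R := by
    rw [top_pre, top_post, hs, h₃, h₂, h₁]
    have : A ++ (L ++ C ++ R) ++ E = (A ++ L ++ C) ++ (R ++ E) := by simp
    rw [this, List.drop_left' (by simp [add_assoc]), List.take_left' rfl]
  have t5 : top (post x₄ s) = E := by
    rw [top_post, hs, h₄, h₃, h₂, h₁]
    have : A ++ (L ++ C ++ R) ++ E = (A ++ L ++ C ++ R) ++ E := by simp
    rw [this, List.drop_left' (by simp [add_assoc])]
  have hs' := (pre_append_post x₄ s).symm
  generalize pre L.length (post x₁ s) = b at *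
  generalize pre C.length (post x₂ s) = c at *
  generalize pre R.length (post x₃ s) = d at *
  generalize post x₄ s = e at *
  have p4' : pre x₄ s = pre x₁ s ++ (b ++ c ++ d) := by rw [p4, p3, p2]; simp
  rw [p4'] at hs'
  have hwbd : weight b + weight d < 2 := by
    rw [p4, p2, p3, p2] at hw
    simp only [weight_append] at hw
    omega
  rw [hs'] at h
  obtain ⟨hb, hd⟩ := h.layer_diag (by rwa [t3]) (by rw [t2, t4]; exact ht.isForest) hwbd
  rw [t2] at hb
  rw [t4] at hd
  subst hb hd
  have hR' := List.length_pos_iff.2 hR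
  have hT : IsTree (L ++ C ++ R) :=
    IsTree.replace (c := []) (by simpa using ht) hL hR IsForest.nil hC
  have hn := h.node_diag (i := 0) (j := R.length - 1) (List.length_pos_iff.2 hL) (by omega)
    (by
      rw [t3]
      exact isNode_of_tree _ _ hT (by simp) (by simp; omega))
  refine ⟨_, c, e, hs', t1, t3, t5, rfl, p4'.symm, ?_⟩
  have hbot : bot s = bot (pre x₁ s) ++ (L ++ bot c ++ R) ++ bot e := by
    conv_lhs => rw [hs']
    simp
  have e1 : (bot (pre x₄ s)).length - 1 =
      (bot (pre x₁ s)).length + (L.length + (bot c).length + (R.length - 1)) := by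
    rw [p4']
    simp
    omega
  rwa [hbot, e1]

/-- The string `X L^e M R^e Y`. -/
def pump (X L M R Y : List (Paren α)) (e : ℕ) : List (Paren α) :=
  X ++ (rep e L ++ M ++ rep e R) ++ Y

theorem isForest_pump {X L M R Y : List (Paren α)} (hXY : IsForest (X ++ Y))
    (ht : IsForest (L ++ R)) (hM : IsForest M) (e : ℕ) : IsForest (pump X L M R Y e) :=
  hXY.insert (isForest_rep ht hM e)

theorem isNode_pump {X L M R Y : List (Paren α)} (ht : IsTree (L ++ R)) (hL : L ≠ [])
    (hR : R ≠ []) (hM : IsForest M) (j n : ℕ) {i i' : ℕ} (hi : i = X.length + j * L.length)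
    (hi' : i' + 1 = X.length + (j + (n + 1)) * L.length + M.length + (n + 1) * R.length) :
    IsNode (pump X L M R Y (j + (n + 1))) (i, i') := by
  have e1 : pump X L M R Y (j + (n + 1)) =
      (X ++ rep j L) ++ (rep (n + 1) L ++ M ++ rep (n + 1) R) ++ (rep j R ++ Y) := by
    have e2 : rep (j + (n + 1)) R = rep (n + 1) R ++ rep j R := by rw [add_comm, rep_add]
    rw [pump, e2, rep_add j (n + 1) L]
    simp
  rw [e1]
  exact isNode_of_tree _ _ (isTree_rep ht hL hR hM n) (by simp [hi]) (by simp [hi']; ring)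

/-- Some layer of the power in the first forest is aligned identically to fragments of the powers
in the second forest. -/
theorem ForestCols.exists_periodic_diag {k n : ℕ} (hk : 1 ≤ k) (he : 6 * k ≤ n + 1)
    {L R X M Y X' M' Y' : List (Paren α)} (ht : IsTree (L ++ R)) (hL : L ≠ []) (hR : R ≠ [])
    (hM : IsForest M) (hM' : IsForest M')
    (ho : |(X.length : ℤ) - X'.length| ≤ 2 * k)
    (hq : |(X.length + M.length : ℤ) - (X'.length + M'.length)| ≤ 2 * k)
    {s : List (Col (Paren α))} (h : ForestCols s) (hs : top s = pump X L M R Y (n + 1))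
    (hs' : bot s = pump X' L M' R Y' (n + 1)) (hedit : nedit s ≤ 2 * k) :
    ∃ j ≤ n, ∃ a c e, s = a ++ (diag L ++ c ++ diag R) ++ e ∧
      top a = X ++ rep j L ∧ top c = rep (n - j) L ++ M ++ rep (n - j) R ∧
      top e = rep j R ++ Y ∧
      X'.length ≤ (bot a).length ∧
      (bot a).length + L.length ≤ X'.length + (n + 1) * L.length ∧
      (bot a).length + L.length + (bot c).length + R.length ≤
        X'.length + (n + 1) * L.length + M'.length + (n + 1) * R.length ∧
      X'.length + (n + 1) * L.length + M'.length ≤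
        (bot a).length + L.length + (bot c).length := by
  have hl := List.length_pos_iff.2 hL
  have hr := List.length_pos_iff.2 hR
  obtain ⟨o, ho_def⟩ : ∃ o, o = X.length := ⟨_, rfl⟩
  obtain ⟨o', ho'_def⟩ : ∃ o, o = X'.length := ⟨_, rfl⟩
  obtain ⟨l, hl_def⟩ : ∃ l, l = L.length := ⟨_, rfl⟩
  obtain ⟨r, hr_def⟩ : ∃ r, r = R.length := ⟨_, rfl⟩
  obtain ⟨q, hq_def⟩ : ∃ q, q = o + (n + 1) * l + M.length + (n + 1) * r := ⟨_, rfl⟩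
  obtain ⟨q', hq'_def⟩ : ∃ q, q = o' + (n + 1) * l + M'.length + (n + 1) * r := ⟨_, rfl⟩
  have hlen : (top s).length = q + Y.length := by
    rw [hs, pump]; simp [hq_def, ho_def, hl_def, hr_def]; ring
  have hw1 := weight_add_ndel s
  have hw2 := nins_add_ndel_le s
  have hcount := two_mul_card_le_weight s (e := n + 1) (l := l) (r := r) (o := o) (q := q)
    (by omega)
  set U : ℕ → Prop := fun j => weight (pre (o + j * l + l) s) + weight (pre (q - j * r) s) <
        weight (pre (o + j * l) s) + weight (pre (q - j * r - r) s) + 2 with hU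
  have : DecidablePred U := fun j => Nat.decLt _ _
  have hcount' : 2 * ((Finset.range (n + 1)).filter fun j => ¬ U j).card ≤ weight s := by
    convert hcount
  have lay : ∀ j ≤ n, U j → ∃ a c e, s = a ++ (diag L ++ c ++ diag R) ++ e ∧
      top a = X ++ rep j L ∧ top c = rep (n - j) L ++ M ++ rep (n - j) R ∧
      top e = rep j R ++ Y ∧ a = pre (o + j * l) s ∧
      a ++ (diag L ++ c ++ diag R) = pre (q - j * r) s ∧
      IsNode (bot s) ((bot (pre (o + j * l) s)).length,
        (bot (pre (q - j * r) s)).length - 1) := by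
    intro j hj hUj
    obtain ⟨m, rfl⟩ := Nat.exists_eq_add_of_le hj
    have e1 : pump X L M R Y (j + m + 1) = (X ++ rep j L) ++
        (L ++ (rep m L ++ M ++ rep m R) ++ R) ++ (rep j R ++ Y) := by
      have e2 : rep (j + m + 1) R = rep m R ++ R ++ rep j R := by
        rw [← rep_succ', ← rep_add]; congr 1; ring
      rw [pump, e2, add_assoc, rep_add, rep_succ]
      simp
    rw [e1] at hs
    have e3 : q = o + j * l + l + (m * l + M.length + m * r) + r + j * r := by
      rw [hq_def]; ring
    have e4 : q - j * r = o + j * l + l + (m * l + M.length + m * r) + r := by omega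
    have e5 : q - j * r - r = o + j * l + l + (m * l + M.length + m * r) := by omega
    rw [Nat.add_sub_cancel_left]
    exact h.exists_diag hs (isForest_rep ht.isForest hM m) ht hL hR (x₂ := o + j * l + l)
      (x₃ := q - j * r - r) (by simp [ho_def, hl_def]) (by rw [hl_def])
      (by rw [e5]; simp [hl_def, hr_def, add_assoc]) (by omega) hUj
  have hbound : ∀ j ≤ n, o + j * l ≤ (top s).length ∧ q - j * r ≤ (top s).length := by
    intro j hj
    have : j * l ≤ (n + 1) * l := by gcongr; omega
    omega
  have hjr : ∀ j ≤ n, j * r ≤ q := by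
    intro j hj
    have : j * r ≤ (n + 1) * r := by gcongr; omega
    omega
  -- The outermost and the innermost copy of the context in the second forest are the nodes against
  -- which images of layers are tested for crossing. The `- 1` appears because `q'` is an exclusive
  -- end.
  have root := isNode_pump (X := X') (Y := Y') ht hL hR hM' 0 n (i := o') (i' := q' - 1)
    (by simp [ho'_def]) (by
      rw [hq'_def, ← ho'_def, ← hl_def, ← hr_def, zero_add]
      have : 0 < (n + 1) * l := Nat.mul_pos (by omega) (by omega)
      omega)
  rw [zero_add, ← hs'] at root
  have last := isNode_pump (X := X') (Y := Y') ht hL hR hM' n 0 (i := o' + n * l)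
    (i' := q' - n * r - 1) (by simp [ho'_def, hl_def]) (by
      rw [← ho'_def, ← hl_def, ← hr_def, zero_add]
      have : 0 < (n + 1) * l := Nat.mul_pos (by omega) (by omega)
      have : (n + 1) * r = n * r + r := by ring
      omega)
  rw [zero_add, ← hs'] at last
  have hnr : n * r + r + 1 ≤ q' := by
    have : 0 < (n + 1) * l := Nat.mul_pos (by omega) (by omega)
    have : (n + 1) * r = n * r + r := by ring
    omega
  obtain ⟨j, hj, hUj, g1, g2, g3, g4⟩ := exists_layer (k := k) (e := n + 1)
    (l := l) (r := r) (o := o) (q := q) (o' := o') (q' := q') (d := ndel s) (i := nins s)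
    (yl := fun j => (bot (pre (o + j * l) s)).length)
    (yr := fun j => (bot (pre (q - j * r) s)).length) (U := U) hk he
    (by omega) (by omega) (by rw [ho_def, ho'_def]; exact ho)
    (by
      rw [hq_def, hq'_def, ho_def, ho'_def]
      push_cast
      have e : ∀ a b c d x y : ℤ, (a + x + b + y) - (c + x + d + y) = a + b - (c + d) :=
        fun _ _ _ _ _ _ => by ring
      rw [e]
      exact hq)
    (by rw [hq_def]; push_cast; nlinarith) (by rw [hq'_def]; push_cast; nlinarith)
    (by positivity) (by positivity) (by omega)
    (by omega)
    (fun j hj => by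
      have := le_length_bot_pre (hbound j (by omega)).1
      simp only [← Nat.cast_mul]
      omega)
    (fun j hj => by
      have := length_bot_pre_le (Nat.zero_le _) (hbound j (by omega)).1
      simp only [pre, bot_nil, List.length_nil] at this
      simp only [← Nat.cast_mul]
      omega)
    (fun j hj => by
      have := le_length_bot_pre (hbound j (by omega)).2
      have := hjr j (by omega)
      simp only [← Nat.cast_mul]
      omega)
    (fun j₀ j₁ h0 h1 => by
      have hm : j₀ * l ≤ j₁ * l := by gcongr
      have := length_bot_pre_le (s := s) (Nat.add_le_add_left hm o) (hbound j₁ (by omega)).1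
      rw [sub_mul]
      simp only [← Nat.cast_mul]
      omega)
    (fun j₀ j₁ h0 h1 => by
      have hm : j₀ * r ≤ j₁ * r := by gcongr
      have := length_bot_pre_le (s := s) (Nat.sub_le_sub_left hm q) (hbound j₀ (by omega)).2
      have := hjr j₁ (by omega)
      rw [sub_mul]
      simp only [← Nat.cast_mul]
      omega)
    (fun j hj hUj h1 h2 => by
      obtain ⟨-, -, -, -, -, -, -, -, -, hn⟩ := lay j (by omega) hUj
      have := hn.snd_lt_snd root (by simp only; omega) (by simp only; omega)
      simp only at this
      omega)
    (fun j hj hUj h1 h2 => by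
      obtain ⟨-, -, -, -, -, -, -, -, -, hn⟩ := lay j (by omega) hUj
      rcases (show o' ≤ (bot (pre (o + j * l) s)).length by omega).eq_or_lt with h | h
      · have := root.snd_le_snd hn h
        simp only at this
        omega
      · have := root.snd_lt_snd hn h (by simp only; omega)
        simp only at this
        omega)
    (fun j hj hUj h1 h2 => by
      obtain ⟨-, -, -, -, -, -, -, -, -, hn⟩ := lay j (by omega) hUj
      push_cast at h1 h2 ⊢
      rw [add_sub_cancel_right] at h1 h2 ⊢
      rw [← Nat.cast_mul] at h1 h2 ⊢
      have := last.snd_lt_snd hn (by simp only; omega) (by simp only; omega)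
      simp only at this
      omega)
  obtain ⟨a, c, e, h1, h2, h3, h4, h5, h6, -⟩ := lay j (by omega) hUj
  refine ⟨j, by omega, a, c, e, h1, h2, h3, h4, ?_⟩
  rw [← h6] at g3 g4
  rw [← h5] at g1 g2
  simp only [bot_append, bot_diag, List.length_append] at g1 g2 g3 g4
  rw [← ho'_def, ← hl_def, ← hr_def]
  rw [← hl_def, ← hr_def] at g3 g4
  push_cast at g2 g4
  have e1 : ((n : ℤ) + 1) * l = ((n + 1) * l : ℕ) := by push_cast; ring
  have e2 : ((n : ℤ) + 1) * r = ((n + 1) * r : ℕ) := by push_cast; ring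
  rw [e1] at g2
  rw [e2] at g4
  omega

/-- One identically aligned copy among `n + 1` becomes `m` copies in both forests, at no cost. The
case `m = 0` lowers the exponent, and larger `m` raise it arbitrarily. -/
theorem ted_pump_add_le {k n : ℕ} (hk : 1 ≤ k) (he : 6 * k ≤ n + 1)
    {L R X M Y X' M' Y' : List (Paren α)} (ht : IsTree (L ++ R)) (hL : L ≠ []) (hR : R ≠ [])
    (hXY : IsForest (X ++ Y)) (hM : IsForest M) (hM' : IsForest M')
    (ho : |(X.length : ℤ) - X'.length| ≤ 2 * k)
    (hq : |(X.length + M.length : ℤ) - (X'.length + M'.length)| ≤ 2 * k)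
    {w : Option α → Option α → ℝ≥0∞} (hw : IsWeight w) (hnorm : IsNormalized w)
    (h : ted w (pump X L M R Y (n + 1)) (pump X' L M' R Y' (n + 1)) ≤ k) (m : ℕ) :
    ted w (pump X L M R Y (n + m)) (pump X' L M' R Y' (n + m)) ≤
      ted w (pump X L M R Y (n + 1)) (pump X' L M' R Y' (n + 1)) := by
  by_contra! hlt
  -- A cost below `k + 1/2` still means fewer than `2k + 1` edits, so a nearly optimal alignment
  -- suffices.
  have hk2 : (k : ℝ≥0∞) < k + 1 / 2 :=
    ENNReal.lt_add_right (ENNReal.natCast_ne_top k) (by simp)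
  obtain ⟨s, hs, hs', hf, hc⟩ := exists_cols_of_ted_lt (lt_min hlt (h.trans_lt hk2))
  rw [lt_min_iff] at hc
  have hedit : nedit s ≤ 2 * k := by
    have h1 := hf.nedit_le hnorm (by rw [hs]; exact isForest_pump hXY ht.isForest hM _)
    have h2 : (nedit s : ℝ≥0∞) < 2 * k + 1 := by
      refine h1.trans_lt ?_
      have := (ENNReal.div_lt_iff (by simp) (by simp)).1 hc.2
      refine this.trans_eq ?_
      rw [add_mul, ENNReal.div_mul_cancel (by simp) (by simp), mul_comm]
    have h3 : nedit s < 2 * k + 1 := by exact_mod_cast h2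
    omega
  obtain ⟨j, hj, a, c, e, rfl, ha, hcc, hee, g1, g2, g3, g4⟩ :=
    hf.exists_periodic_diag hk he ht hL hR hM hM' ho hq hs hs' hedit
  have hC : IsForest (top c) := by rw [hcc]; exact isForest_rep ht.isForest hM _
  have hC' := hf.isForest_bot hC ht hL hR
  have hLR : IsForest (rep m L ++ rep m R) := by
    simpa using isForest_rep ht.isForest IsForest.nil m
  have hnew := ted_le (w := w) (hf.replace hC hC' ht.isForest hLR)
  have hw' : ∀ p, parenWeight w p p = 0 := fun p => hw _
  simp only [colCost_append, colCost_diag _ hw'] at hnew hc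
  refine absurd hc.1 (not_lt.2 (le_of_eq_of_le ?_ hnew))
  obtain ⟨i, rfl⟩ := Nat.exists_eq_add_of_le hj
  rw [Nat.add_sub_cancel_left] at hcc
  congr 1
  · have e1 : rep (j + i + m) L = rep j L ++ rep m L ++ rep i L := by
      rw [← rep_add, ← rep_add]; congr 1; ring
    have e2 : rep (j + i + m) R = rep i R ++ rep m R ++ rep j R := by
      rw [← rep_add, ← rep_add]; congr 1; ring
    simp [pump, ha, hcc, hee, e1, e2]
  · simp only [bot_append, bot_diag, pump] at hs' ⊢
    -- The images of the two halves are exchanged separately: first in the power of `L`, then in the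
    -- power of `R` within what remains. Nothing relates the two offsets.
    obtain ⟨p, t, hp, hct, hpt, hrep⟩ := exists_rep_replace (P := bot a) (L := L)
      (S := bot c ++ R ++ bot e) (X := X') (Z := M' ++ rep (j + i + 1) R ++ Y') (e := j + i)
      (by simpa using hs') g1 g2
    have hX : (bot a).length = X'.length + p.length := by rw [hp]; simp
    have hlen := congrArg List.length hct
    simp only [List.length_append, length_rep] at hlen
    rw [Nat.add_mul _ _ L.length, one_mul] at g2 g3 g4
    obtain ⟨p', t', hp', het', -, hrep'⟩ := exists_rep_replace (P := bot c) (L := R)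
      (S := bot e) (X := t ++ M') (Z := Y') (e := j + i) (by simpa using hct)
      (by simp; omega) (by simp; omega)
    rw [← hrep m, ← hrep' m, hp, hp', het']
    simp

/-- Powers of a context with large exponents can be replaced by each other. -/
theorem ted_pump_le {k e e' : ℕ} (hk : 1 ≤ k) (he : 6 * k ≤ e) (he' : 6 * k ≤ e')
    {L R X M Y X' M' Y' : List (Paren α)} (ht : IsTree (L ++ R)) (hL : L ≠ []) (hR : R ≠ [])
    (hXY : IsForest (X ++ Y)) (hM : IsForest M) (hM' : IsForest M')
    (ho : |(X.length : ℤ) - X'.length| ≤ 2 * k)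
    (hq : |(X.length + M.length : ℤ) - (X'.length + M'.length)| ≤ 2 * k)
    {w : Option α → Option α → ℝ≥0∞} (hw : IsWeight w) (hnorm : IsNormalized w)
    (h : ted w (pump X L M R Y e) (pump X' L M' R Y' e) ≤ k) :
    ted w (pump X L M R Y e') (pump X' L M' R Y' e') ≤
      ted w (pump X L M R Y e) (pump X' L M' R Y' e) := by
  have step : ∀ n m, 6 * k ≤ n + 1 →
      ted w (pump X L M R Y (n + 1)) (pump X' L M' R Y' (n + 1)) ≤ k →
      ted w (pump X L M R Y (n + m)) (pump X' L M' R Y' (n + m)) ≤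
        ted w (pump X L M R Y (n + 1)) (pump X' L M' R Y' (n + 1)) := fun n m hn h =>
    ted_pump_add_le hk hn ht hL hR hXY hM hM' ho hq hw hnorm h m
  rcases le_total e e' with hle | hle
  · obtain ⟨n, rfl⟩ : ∃ n, e = n + 1 := ⟨e - 1, by omega⟩
    obtain ⟨m, rfl⟩ := Nat.exists_eq_add_of_le hle
    have := step n (m + 1) he h
    rwa [show n + (m + 1) = n + 1 + m by ring] at this
  -- Only one layer is known to be removable at a time, so the exponent descends by ones; it is at
  -- least `6k` before each removal, and the distance stays at most `k`.
  · induction e, hle using Nat.le_induction with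
    | base => exact le_rfl
    | succ n hn ih =>
      have h1 := step n 0 he h
      exact (ih (by omega) (h1.trans h)).trans h1

/-! ### Contexts -/

namespace StringPair

theorem pow_left (Q : StringPair α) (e : ℕ) : (Q.pow e).left = rep e Q.left := by
  induction e with
  | zero => rfl
  | succ e ih => rw [rep_succ, ← ih]; rfl

theorem pow_right (Q : StringPair α) (e : ℕ) : (Q.pow e).right = rep e Q.right := by
  induction e with
  | zero => rfl
  | succ e ih => rw [rep_succ', ← ih]; rfl

theorem IsContext.pow {Q : StringPair α} (hQ : Q.IsContext) {e : ℕ} (he : 1 ≤ e) :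
    (Q.pow e).IsContext := by
  obtain ⟨n, rfl⟩ : ∃ n, e = n + 1 := ⟨e - 1, by omega⟩
  obtain ⟨ht, hL, hR⟩ := hQ
  refine ⟨?_, ?_, ?_⟩
  · rw [pow_left, pow_right]
    simpa using isTree_rep ht hL hR IsForest.nil n
  · rw [pow_left, rep_succ]
    simp [hL]
  · rw [pow_right, rep_succ]
    simp [hR]

/-- This passes from positions to a factorization whose outer parts and filling do not depend on the
exponent, so that replacement merely changes the exponent. -/
theorem OccursAt.exists_pump {Q : StringPair α} {e : ℕ} {F : List (Paren α)} {u : ℕ × ℕ}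
    (h : (Q.pow e).OccursAt F u) (hF : IsForest F) :
    ∃ X M Y, F = pump X Q.left M Q.right Y e ∧ IsForest M ∧ IsForest (X ++ Y) ∧
      X.length = u.1 ∧
      u.2 + 1 = X.length + e * Q.left.length + M.length + e * Q.right.length ∧
      ∀ e', replaceAt (Q.pow e) (Q.pow e') F u = pump X Q.left M Q.right Y e' := by
  obtain ⟨hu, M, hM, hT⟩ := h
  have htree := hu.2.2
  rw [hT] at htree
  simp only [fill, pow_left, pow_right] at hT htree
  obtain ⟨h1, h2, -⟩ := hu
  have e1 : F = F.take u.1 ++ frag F u.1 (u.2 + 1) ++ F.drop (u.2 + 1) := by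
    have : F.take u.1 = (F.take (u.2 + 1)).take u.1 := by
      rw [List.take_take, min_eq_left (by omega)]
    rw [this, frag, List.take_append_drop, List.take_append_drop]
  have hlen : (frag F u.1 (u.2 + 1)).length = u.2 + 1 - u.1 := by
    simp [frag]; omega
  have hX : (F.take u.1).length = u.1 := by simp; omega
  have hfr : ∀ i, frag F i F.length = F.drop i := by intro i; simp [frag]
  have hY := hfr (u.2 + 1)
  have h0 : frag F 0 u.1 = F.take u.1 := by simp [frag]
  rw [hT] at e1 hlen
  simp only [List.length_append, length_rep] at hlen
  refine ⟨F.take u.1, M, F.drop (u.2 + 1), e1, hM, ?_, hX, by omega, fun e' => ?_⟩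
  · rw [e1] at hF
    simpa using hF.replace htree.isForest IsForest.nil
  · have hm : frag F (u.1 + (Q.pow e).left.length) (u.2 + 1 - (Q.pow e).right.length) = M := by
      simp only [pow_left, pow_right, length_rep]
      have e2 : F = (F.take u.1 ++ rep e Q.left) ++ M ++ (rep e Q.right ++ F.drop (u.2 + 1)) := by
        conv_lhs => rw [e1]
        simp
      have e3 : u.1 + e * Q.left.length = (F.take u.1 ++ rep e Q.left).length + 0 := by
        simp only [List.length_append, length_rep, hX, add_zero]
      have e4 : u.2 + 1 - e * Q.right.length =
          (F.take u.1 ++ rep e Q.left).length + M.length := by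
        simp only [List.length_append, length_rep, hX]
        omega
      have e5 := frag_append (P := F.take u.1 ++ rep e Q.left) (s := M)
        (S := rep e Q.right ++ F.drop (u.2 + 1)) (i := 0) le_rfl
      rw [← e2] at e5
      rw [e3, e4, e5]
      simp [frag]
    rw [replaceAt, hm, h0, hY, pow_left, pow_right, pump]
    simp

end StringPair

end TreeEdit

/-! ### Equivalence of large powers -/

theorem mainTheorem11 {α : Type*} (k : ℕ) (hk : 1 ≤ k)
    (Q : TreeEdit.StringPair α) (hQ : Q.IsContext)
    (e e' : ℕ) (he : 6 * k ≤ e) (he' : 6 * k ≤ e')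
    (w : Option α → Option α → ENNReal)
    (hw : TreeEdit.IsWeight w) (hnorm : TreeEdit.IsNormalized w) :
    TreeEdit.StringPair.TedEquiv k w (Q.pow e) (Q.pow e') := by
  refine ⟨hQ.pow (by omega), hQ.pow (by omega), ?_⟩
  intro F G u v hF hG hu hv h1 h2
  obtain ⟨X, M, Y, rfl, hM, hXY, hX, hl, hrep⟩ := hu.exists_pump hF
  obtain ⟨X', M', Y', rfl, hM', -, hX', hl', hrep'⟩ := hv.exists_pump hG
  rw [hrep, hrep']
  obtain ⟨ht, hL, hR⟩ := hQ
  have ho : |(X.length : ℤ) - X'.length| ≤ 2 * k := by rw [hX, hX']; exact h1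
  -- The lengths of the two powers cancel in the difference of the closing positions, so this form
  -- of the hypothesis serves for both exponents.
  have hq : |(X.length + M.length : ℤ) - (X'.length + M'.length)| ≤ 2 * k := by
    rw [abs_le] at h2 ⊢
    omega
  have key := fun (a b : ℕ) (ha : 6 * k ≤ a) (hb : 6 * k ≤ b) =>
    TreeEdit.ted_pump_le (Y := Y) (Y' := Y') hk ha hb ht hL hR hXY hM hM' ho hq hw hnorm
  have hkk : ((k : NNReal) : ENNReal) = (k : ENNReal) := by simp
  simp only [TreeEdit.tedLE, hkk]
  by_cases h : TreeEdit.ted w (TreeEdit.pump X Q.left M Q.right Y e)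
      (TreeEdit.pump X' Q.left M' Q.right Y' e) ≤ k
  · have h3 := key e e' he he' h
    have h4 := key e' e he' he (h3.trans h)
    rw [if_pos h, if_pos (h3.trans h), le_antisymm h4 h3]
  · rw [if_neg h, if_neg fun h' => h ((key e' e he' he h').trans h')]
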